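/- Let $k\ge 1$, let ${\mathcal X}=\{x\in\mathbb R^k:\|x\|\le\tfrac12\}$ with the Euclidean distance $d$, and let ${\mathcal C}_{\mathrm{HS}}$ be the class of half-spaces $\{x\in{\mathcal X}:\langle\omega,x\rangle\ge b\}$ with $\omega\in\mathbb R^k$, $b\in\mathbb R$. The error of $C\subseteq{\mathcal X}$ with respect to a target $\ell$ is $\mathrm{err}(C,\ell)=\Pr_x[\ell(x)\ne C(x)]$ for $x$ uniform on ${\mathcal X}$, where subsets are identified with their indicator functions. For a target $\ell$ and $x\in{\mathcal X}$, let $\mathrm{CE}_{\min}(x)$ be the set of points closest to $x$ in the closure of $\{y\in{\mathcal X}:\ell(y)\ne\ell(x)\}$. For a non-decreasing $f:\mathbb R^{\ge0}\to\mathbb R^{\ge0}$, the mechanism $\mathrm{CE}^{d,f}_{\mathrm{prob}}$ (probabilistic approximate minimum distance model, AMDM) allows an oracle given by any measurable family $({\mathcal D}_x)_{x\in{\mathcal X}}$ of probability distributions on ${\mathcal X}$ such that, for every $x$, a draw $x'\sim{\mathcal D}_x$ almost surely satisfies $\ell(x')\neq\ell(x)$ or $x'\in\mathrm{CE}_{\min}(x)$,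 and $\mathbb E_{x'\sim{\mathcal D}_x}[d(x',x_{\min})]\le f(d(x,x_{\min}))$ for some $x_{\min}\in\mathrm{CE}_{\min}(x)$. (For a target that is constant on ${\mathcal X}$ no such oracle exists, so such targets impose no condition.) An active learner, possibly randomized, adaptively chooses query points $x_1,x_2,\dots$ based on the examples seen so far; for each query it receives $(x_i,\ell(x_i))$ and $(x_i',\ell(x_i'))$, where $x_i'$ is drawn from ${\mathcal D}_{x_i}$ independently of the past given $x_i$. After $m$ steps it outputs a hypothesis $C_m\in{\mathcal C}_{\mathrm{HS}}$. The active contrastive sample complexity ${\mathcal M}_{\Pr,\mathrm{active}}[{\mathcal C}_{\mathrm{HS}},\mathrm{CE}^{d,f}_{\mathrm{prob}}](\varepsilon,\delta)$ is the infimum, over all active learners, of the least $m^*\in\mathbb N$ such that $\Pr[\mathrm{err}(C_m,\ell)>\varepsilon]<\delta$ for every $\ell\in{\mathcal C}_{\mathrm{HS}}$, every admissible oracle and every $m\ge m^*$ (and $\infty$ if there is no such $m^*$). Let $c>0$ and let $f:\mathbb R^{\ge0}\to\mathbb R^{\ge0}$ be non-decreasing with $f(x)\le \tfrac{x^{1+c}}4$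 for all $x\geq 0$. Put $\tilde f(x)=3f(2x)$ and, for $\varepsilon\in(0,1]$, $\varepsilon'=\bigl(\tfrac{\varepsilon}{2^{k-1}}\bigr)^{1/c}$, and let $S=\min\{n\ge0:\tilde f^{(n)}(\tfrac12)\le\varepsilon'\}$, where $\tilde f^{(n)}$ is the $n$-fold composition and $S=\infty$ if there is no such $n$. Then for all $\varepsilon,\delta\in(0,1]$ $${\mathcal M}_{\Pr,\mathrm{active}}\left[{\mathcal C}_{\mathrm{HS}},\mathrm{CE}^{d,f}_{\mathrm{prob}}\right](\varepsilon,\delta)\le 32\,S+136\log_2\frac3\delta .$$ -/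

import Mathlib

open MeasureTheory ProbabilityTheory Set
open scoped NNReal ENNReal

noncomputable section

namespace Contrastive

/-- A concept (labeling rule) is a subset `ℓ` of the instance space; the label of `x` is the truth
value of `x ∈ ℓ`. `oppositeLabel ℓ x` is the set of instances whose label differs from that of
`x`. -/
def oppositeLabel {X : Type*} (ℓ : Set X) (x : X) : Set X :=
  {y | ¬ (y ∈ ℓ ↔ x ∈ ℓ)}

/-- The ideal contrastive examples for `x`: the points of `X` closest to `x` among all limits of
sequences of points whose label differs from that of `x`. -/
def ceMin {X : Type*} [MetricSpace X] (ℓ : Set X) (x : X) : Set X :=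
  {x' | x' ∈ closure (oppositeLabel ℓ x) ∧
    ∀ y ∈ closure (oppositeLabel ℓ x), dist x x' ≤ dist x y}

/-- A stochastic mechanism for selecting contrastive examples: for each labeling rule `ℓ`, the
families `x ↦ D x` of laws of the contrastive example that the oracle may use. -/
abbrev Mechanism (X : Type*) [MeasurableSpace X] := Set X → Set (Kernel X X)

/-- The probabilistic approximate minimum distance model with noise function `f`. The law `D x` is
a probability measure on the points whose label differs from that of `x`, with
`E d(x', xmin) ≤ f (d(x, xmin))` for some ideal contrastive example `xmin` of `x`.
As in the minimum distance model, an ideal example may itself be returned even if, being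
only a limit of points of the other label, it does not carry the other label; otherwise no
admissible law would exist for `x` on the decision boundary when `f 0 = 0`. -/
def probAMDM {X : Type*} [MetricSpace X] [MeasurableSpace X] (f : ℝ≥0 → ℝ≥0) : Mechanism X :=
  fun ℓ => {D | IsMarkovKernel D ∧ ∀ x,
    (∀ᵐ x' ∂(D x), x' ∈ oppositeLabel ℓ x ∨ x' ∈ ceMin ℓ x) ∧
    ∃ xmin ∈ ceMin ℓ x, ∫⁻ x', edist x' xmin ∂(D x) ≤ (f (nndist x xmin) : ℝ≥0∞)}

/-- What the learner has seen after `n` steps: the pairs `((x, ℓ(x)), (x', ℓ(x')))` of a primary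
and a contrastive labeled example. -/
abbrev History (X : Type*) (n : ℕ) := Fin n → (X × Prop) × (X × Prop)

/-- A (possibly randomized) active learning algorithm with hypotheses in the class `𝒞`. It draws a
random seed, and then the next query and the current hypothesis are functions of the seed
and the history. -/
structure ActiveLearner (X : Type*) [MeasurableSpace X] (𝒞 : Set (Set X)) where
  Seed : Type
  [measurableSpaceSeed : MeasurableSpace Seed]
  seedLaw : Measure Seed
  [isProbabilityMeasure_seedLaw : IsProbabilityMeasure seedLaw]
  query : ∀ n, Seed × History X n → X
  measurable_query : ∀ n, Measurable (query n)
  hypothesis : ∀ n, Seed × History X n → Set X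
  hypothesis_mem : ∀ n p, hypothesis n p ∈ 𝒞

attribute [instance] ActiveLearner.measurableSpaceSeed ActiveLearner.isProbabilityMeasure_seedLaw

/-- The history after one more step, with query `x` and contrastive example `x'`. -/
def extend {X : Type*} (ℓ : Set X) {n : ℕ} (h : History X n) (x x' : X) : History X (n + 1) :=
  Fin.snoc (α := fun _ => (X × Prop) × (X × Prop)) h ((x, x ∈ ℓ), (x', x' ∈ ℓ))

/-- The joint law of the seed and the history after `n` steps, when the target is `ℓ` and the
contrastive example for a query `x` is drawn from `D x`, independently of the past given `x`. -/
def run {X : Type*} [MeasurableSpace X] {𝒞 : Set (Set X)} (A : ActiveLearner X 𝒞) (ℓ : Set X)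
    (D : Kernel X X) : ∀ n, Measure (A.Seed × History X n)
  | 0 => A.seedLaw.map (fun s => (s, Fin.elim0))
  | n + 1 => ((run A ℓ D n) ⊗ₘ (D.comap (A.query n) (A.measurable_query n))).map
      (fun q => (q.1.1, extend ℓ q.1.2 (A.query n q.1) q.2))

/-- The error of `C` with respect to `ℓ` under the distribution `μ`. -/
def err {X : Type*} [MeasurableSpace X] (μ : Measure X) (C ℓ : Set X) : ℝ :=
  μ.real {x | ¬ (x ∈ ℓ ↔ x ∈ C)}

/-- The contrastive sample complexity of the algorithm `A` on `𝒞`: the least `m` such that for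
every target, every admissible oracle and every `n ≥ m`, the hypothesis after `n` steps has error
more than `ε` with probability less than `δ` (`⊤` if there is no such `m`). A set that is not
measurable is measured by its outer measure. -/
def sampleComplexityOf {X : Type*} [MeasurableSpace X] (μ : Measure X) (𝒞 : Set (Set X))
    (CE : Mechanism X) (A : ActiveLearner X 𝒞) (ε δ : ℝ) : ℕ∞ :=
  ⨅ (m : ℕ) (_ : ∀ ℓ ∈ 𝒞, ∀ D ∈ CE ℓ, ∀ n ≥ m,
    (run A ℓ D n) {p | ε < err μ (A.hypothesis n p) ℓ} < ENNReal.ofReal δ), (m : ℕ∞)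

/-- The active contrastive sample complexity of `𝒞`. -/
def activeSampleComplexity {X : Type*} [MeasurableSpace X] (μ : Measure X) (𝒞 : Set (Set X))
    (CE : Mechanism X) (ε δ : ℝ) : ℕ∞ :=
  ⨅ A : ActiveLearner X 𝒞, sampleComplexityOf μ 𝒞 CE A ε δ

/-- The closed Euclidean ball of radius `1/2` around the origin of `ℝ^k`. -/
abbrev HalfBall (k : ℕ) : Type :=
  {x : EuclideanSpace ℝ (Fin k) // x ∈ Metric.closedBall (0 : EuclideanSpace ℝ (Fin k)) (1 / 2)}

/-- The uniform distribution on the ball. -/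
def uniform (k : ℕ) : Measure (HalfBall k) :=
  (volume (Metric.closedBall (0 : EuclideanSpace ℝ (Fin k)) (1 / 2)))⁻¹ •
    Measure.comap Subtype.val volume

/-- The class of (general, not necessarily homogeneous) half-spaces over the ball. -/
def halfSpaces (k : ℕ) : Set (Set (HalfBall k)) :=
  {ℓ | ∃ (w : EuclideanSpace ℝ (Fin k)) (b : ℝ), 
    ℓ = {x | b ≤ inner ℝ w x.1}}

/-- The least number of iterations of `f` that brings `u` down to at most `b`; `⊤` if there is
none. -/
def iterationCount (f : ℝ≥0 → ℝ≥0) (u : ℝ≥0) (b : ℝ) : ℕ∞ :=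
  ⨅ (n : ℕ) (_ : ((f^[n] u : ℝ≥0) : ℝ) ≤ b), (n : ℕ∞)

end Contrastive

end

/-! Search. By Markov's inequality, the contrastive example of a point at distance `g` from the
boundary lies within `2 * f g` of a nearest boundary point with probability at least 1/2. So
contrastive examples of contrastive examples approach the boundary quickly. Progress can also be
verified: a point and its contrastive example are never strictly on the same side, so their distance
bounds the distance of the point to the boundary. An attempt costs two queries: the contrastive
example of the current point becomes a candidate, and the candidate is accepted if its own
contrastive example is near enough. An attempt succeeds with probability at least 1/4, passes from
radius `r` to `3 * f r`, and loses nothing when it fails. A potential carrying a factor 4 per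
missing level shrinks in expectation by 13/16 per attempt (`lintegral_searchPotential_le`), so a
number of attempts linear in `S + log (1/δ)` suffices.

Decoding. The last accepted pair, or the random seed if the hyperplane passes through the center,
yields a point `y` off the hyperplane, within `tol` of it, whose orthogonal projection lies in the
ball (`isNice_settle`). At `y` the noise is at most a fraction `tol ^ c / 4` of the distance to the
hyperplane. Two half-spaces that agree with one and the same example at `y` therefore have nearby
normals and offsets (`normal_and_offset_close`) and differ only in a thin slab of measure at most
`ε` (`err_halfSpace_le`); the factor `2 ^ (k - 1)` pays for the ratio of ball volumes in consecutive
dimensions.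

Vote. The point `y` is queried again and again. Each example agrees with the target with probability
at least 7/12, so the target explains a strict majority except with exponentially small probability
(`lintegral_votePotential_le`). Any other half-space explaining a majority shares an example with
the target, hence is `ε`-close to it (`err_le_of_explains`), so an arbitrary choice is good. -/

namespace Contrastive

/-! ### Ball volumes and the measure of slabs -/

/-- The volume of the ball of radius `1/2` in dimension `n`. -/
noncomputable def ballVol (n : ℕ) : ℝ :=
  (1 / 2) ^ n * (√Real.pi ^ n / Real.Gamma ((n : ℝ) / 2 + 1))

lemma ballVol_pos (n : ℕ) : 0 < ballVol n := by
  unfold ballVol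
  have : 0 < Real.Gamma ((n : ℝ) / 2 + 1) := Real.Gamma_pos_of_pos (by positivity)
  positivity

lemma volume_closedBall_half (n : ℕ) :
    volume (Metric.closedBall (0 : EuclideanSpace ℝ (Fin n)) (1 / 2)) =
      ENNReal.ofReal (ballVol n) := by
  rcases n with _ | n
  · have : Metric.closedBall (0 : EuclideanSpace ℝ (Fin 0)) (1 / 2) =
        (WithLp.ofLp) ⁻¹' (univ : Set (Fin 0 → ℝ)) := by
      ext x
      simp [Subsingleton.elim x 0]
    rw [this, (PiLp.volume_preserving_ofLp (Fin 0)).measure_preimage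
      MeasurableSet.univ.nullMeasurableSet]
    simp [ballVol, volume_pi]
  · rw [EuclideanSpace.volume_closedBall, ← ENNReal.ofReal_pow (by norm_num),
      ← ENNReal.ofReal_mul (by positivity)]
    simp [ballVol]

lemma ballVol_add_two (n : ℕ) : ballVol (n + 2) = ballVol n * (Real.pi / (2 * (n + 2))) := by
  unfold ballVol
  have h : ((n + 2 : ℕ) : ℝ) / 2 + 1 = ((n : ℝ) / 2 + 1) + 1 := by push_cast; ring
  have hp : 0 < Real.Gamma ((n : ℝ) / 2 + 1) := Real.Gamma_pos_of_pos (by positivity)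
  rw [h, Real.Gamma_add_one (by positivity)]
  have hs : √Real.pi ^ (n + 2) = √Real.pi ^ n * Real.pi := by
    rw [pow_add, Real.sq_sqrt Real.pi_pos.le]
  rw [hs]
  field_simp
  ring

lemma ballVol_zero : ballVol 0 = 1 := by simp [ballVol]

lemma ballVol_one : ballVol 1 = 1 := by
  have h : ((1 : ℕ) : ℝ) / 2 + 1 = 1 / 2 + 1 := by norm_num
  have : 0 < √Real.pi := Real.sqrt_pos.2 Real.pi_pos
  rw [ballVol, h, Real.Gamma_add_one (by norm_num), Real.Gamma_one_half_eq]
  field_simp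

/-- The volume recursion relates dimensions of equal parity, so two consecutive inequalities are
carried through the induction. The first is an equality for `n = 0`. -/
lemma ballVol_ratio (n : ℕ) :
    ballVol (n + 1) ≤ 2 ^ (n + 2) / Real.pi * ballVol (n + 2) ∧
      ballVol (n + 2) ≤ 2 ^ (n + 3) / Real.pi * ballVol (n + 3) := by
  have hpi := Real.pi_pos
  induction n with
  | zero =>
    have h2 := ballVol_add_two 0
    have h3 := ballVol_add_two 1
    rw [ballVol_zero] at h2
    rw [ballVol_one] at h3
    norm_num at h2 h3 ⊢
    rw [h2, h3, ballVol_one]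
    refine ⟨le_of_eq (by field_simp), ?_⟩
    have : Real.pi ≤ 4 := Real.pi_le_four
    have e : 8 / Real.pi * (Real.pi / 6) = 4 / 3 := by field_simp; norm_num
    rw [e]
    linarith
  | succ n ih =>
    refine ⟨ih.2, ?_⟩
    have h2 := ballVol_add_two (n + 1)
    have h3 := ballVol_add_two (n + 2)
    have p1 := ballVol_pos (n + 1)
    have p2 := ballVol_pos (n + 2)
    have e1 : n + 1 + 2 = n + 3 := rfl
    have e2 : n + 2 + 2 = n + 1 + 3 := rfl
    rw [e1] at h2
    rw [e2] at h3
    rw [show n + 1 + 2 = n + 3 from rfl, h2, h3]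
    push_cast
    calc ballVol (n + 1) * (Real.pi / (2 * (n + 1 + 2)))
        ≤ (2 ^ (n + 2) / Real.pi * ballVol (n + 2)) * (Real.pi / (2 * (n + 1 + 2))) := by
          gcongr
          exact ih.1
      -- The bound gains a factor 4 over two dimensions, which more than covers the quotient `(n +
      -- 4) / (n + 3)` of the recursion factors.
      _ ≤ (2 ^ (n + 2) / Real.pi * ballVol (n + 2)) * (4 * (Real.pi / (2 * (n + 2 + 2)))) := by
          gcongr
          rw [← mul_div_assoc, div_le_div_iff₀ (by positivity) (by positivity)]
          nlinarith
      _ = _ := by ring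

/-- In an orthonormal basis beginning with `e`, the slab lies in the product of an interval of
length `2 * h` and a ball of one dimension less, since dropping a coordinate does not increase the
norm. -/
lemma volume_slab_le {n : ℕ} (e : EuclideanSpace ℝ (Fin (n + 1))) (he : ‖e‖ = 1) (β h : ℝ) :
    volume {x : EuclideanSpace ℝ (Fin (n + 1)) | ‖x‖ ≤ 1 / 2 ∧ |inner ℝ e x - β| ≤ h} ≤
      ENNReal.ofReal (2 * h) * ENNReal.ofReal (ballVol n) := by
  classical
  obtain ⟨b, hb⟩ : ∃ b : OrthonormalBasis (Fin (n + 1)) ℝ (EuclideanSpace ℝ (Fin (n + 1))),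
      b 0 = e := by
    have ho : Orthonormal ℝ (({0} : Set (Fin (n + 1))).domRestrict (fun _ => e)) := by
      refine ⟨fun i => by simpa using he, fun i j hij => ?_⟩
      exact absurd (Subsingleton.elim i j) hij
    obtain ⟨b, hb⟩ := ho.exists_orthonormalBasis_extension_of_card_eq (by simp)
    exact ⟨b, hb 0 rfl⟩
  let A : Set (ℝ × (Fin n → ℝ)) :=
    Icc (β - h) (β + h) ×ˢ
      (WithLp.toLp 2 ⁻¹' (Metric.closedBall (0 : EuclideanSpace ℝ (Fin n)) (1 / 2)))
  have hmt : MeasurableSet (WithLp.toLp 2 ⁻¹'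
      (Metric.closedBall (0 : EuclideanSpace ℝ (Fin n)) (1 / 2))) :=
    (PiLp.volume_preserving_toLp (Fin n)).measurable measurableSet_closedBall
  have hA : MeasurableSet A := measurableSet_Icc.prod hmt
  let φ : EuclideanSpace ℝ (Fin (n + 1)) → ℝ × (Fin n → ℝ) :=
    fun x => MeasurableEquiv.piFinSuccAbove (fun _ => ℝ) 0 (WithLp.ofLp (b.repr x))
  have hφ : MeasurePreserving φ volume volume :=
    ((volume_preserving_piFinSuccAbove (fun _ : Fin (n + 1) => ℝ) 0).comp
      (PiLp.volume_preserving_ofLp (Fin (n + 1)))).comp b.measurePreserving_repr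
  have hsub : {x : EuclideanSpace ℝ (Fin (n + 1)) | ‖x‖ ≤ 1 / 2 ∧ |inner ℝ e x - β| ≤ h} ⊆
      φ ⁻¹' A := by
    rintro x ⟨hx, hs⟩
    refine ⟨?_, ?_⟩
    · have : (φ x).1 = inner ℝ e x := by
        change (b.repr x) 0 = _
        rw [b.repr_apply_apply, hb]
      rw [this]
      rw [abs_le] at hs
      constructor <;> linarith [hs.1, hs.2]
    · have h1 : (φ x).2 = fun i : Fin n => (b.repr x) i.succ := by
        ext i
        rfl
      rw [h1, mem_preimage, mem_closedBall_zero_iff]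
      refine le_trans ?_ hx
      rw [← b.repr.norm_map x, EuclideanSpace.norm_eq, EuclideanSpace.norm_eq]
      refine Real.sqrt_le_sqrt ?_
      rw [Fin.sum_univ_succ]
      simp only [le_add_iff_nonneg_left]
      positivity
  calc _ ≤ volume (φ ⁻¹' A) := measure_mono hsub
    _ = volume A := hφ.measure_preimage hA.nullMeasurableSet
    _ = _ := by
      rw [Measure.volume_eq_prod, Measure.prod_prod,
        (PiLp.volume_preserving_toLp (Fin n)).measure_preimage
          measurableSet_closedBall.nullMeasurableSet, volume_closedBall_half, Real.volume_Icc]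
      congr 2
      ring

lemma uniform_slab_le {n : ℕ} (e : EuclideanSpace ℝ (Fin (n + 1))) (he : ‖e‖ = 1) (β h : ℝ)
    (hh : 0 ≤ h) :
    uniform (n + 1) {x | |inner ℝ e x.1 - β| ≤ h} ≤
      ENNReal.ofReal (2 * h * ballVol n / ballVol (n + 1)) := by
  have hp := ballVol_pos (n + 1)
  have hp' := ballVol_pos n
  rw [uniform, Measure.smul_apply, comap_subtype_coe_apply measurableSet_closedBall,
    volume_closedBall_half, smul_eq_mul, ← ENNReal.ofReal_inv_of_pos hp]
  have : Subtype.val '' {x : HalfBall (n + 1) | |inner ℝ e x.1 - β| ≤ h} ⊆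
      {x : EuclideanSpace ℝ (Fin (n + 1)) | ‖x‖ ≤ 1 / 2 ∧ |inner ℝ e x - β| ≤ h} := by
    rintro _ ⟨x, hx, rfl⟩
    exact ⟨mem_closedBall_zero_iff.1 x.2, hx⟩
  calc _ ≤ ENNReal.ofReal (ballVol (n + 1))⁻¹ *
        (ENNReal.ofReal (2 * h) * ENNReal.ofReal (ballVol n)) := by
        gcongr
        exact (measure_mono this).trans (volume_slab_le e he β h)
    _ = _ := by
      rw [← ENNReal.ofReal_mul (by positivity), ← ENNReal.ofReal_mul (by positivity)]
      congr 1
      field_simp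

instance isProbabilityMeasure_uniform (k : ℕ) : IsProbabilityMeasure (uniform k) := by
  constructor
  rw [uniform, Measure.smul_apply, comap_subtype_coe_apply measurableSet_closedBall]
  have : Subtype.val '' (univ : Set (HalfBall k)) =
      Metric.closedBall (0 : EuclideanSpace ℝ (Fin k)) (1 / 2) := by
    ext x
    simp
  rw [this, volume_closedBall_half, smul_eq_mul]
  exact ENNReal.inv_mul_cancel (by simpa using ballVol_pos k) ENNReal.ofReal_ne_top

lemma uniform_hyperplane {n : ℕ} (e : EuclideanSpace ℝ (Fin (n + 1))) (he : ‖e‖ = 1) :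
    uniform (n + 1) {x | inner ℝ e x.1 = 0} = 0 := by
  have h := uniform_slab_le e he 0 0 le_rfl
  simp only [mul_zero, zero_mul, zero_div, ENNReal.ofReal_zero, nonpos_iff_eq_zero, sub_zero,
    abs_nonpos_iff] at h
  exact h

/-! ### Half-spaces with close parameters have small error -/

/-- The signed distance of `x` from the hyperplane `⟨w, ·⟩ = b`, for a unit vector `w`. -/
noncomputable def margin {k : ℕ} (w : EuclideanSpace ℝ (Fin k)) (b : ℝ) (x : HalfBall k) : ℝ :=
  inner ℝ w x.1 - b

/-- The orthogonal projection of `x` to the hyperplane `⟨w, ·⟩ = b`, for a unit vector `w`. -/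
noncomputable def foot {k : ℕ} (w : EuclideanSpace ℝ (Fin k)) (b : ℝ) (x : HalfBall k) :
    EuclideanSpace ℝ (Fin k) :=
  x.1 - margin w b x • w

/-- The half-space `⟨w, ·⟩ ≥ b` of the ball. -/
def halfSpace {k : ℕ} (w : EuclideanSpace ℝ (Fin k)) (b : ℝ) : Set (HalfBall k) :=
  {x | b ≤ inner ℝ w x.1}

lemma mem_halfSpace {k : ℕ} {w : EuclideanSpace ℝ (Fin k)} {b : ℝ} {x : HalfBall k} :
    x ∈ halfSpace w b ↔ 0 ≤ margin w b x := by
  simp [halfSpace, margin]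

lemma HalfBall.norm_le {k : ℕ} (x : HalfBall k) : ‖x.1‖ ≤ 1 / 2 :=
  mem_closedBall_zero_iff.1 x.2

/-- Where the labels differ, the two margins have opposite signs, so their sum is bounded by their
difference. The sum is affine with normal `w + w'`, so its small values form a slab around a
bisecting hyperplane. -/
lemma err_halfSpace_le_slab {n : ℕ} {w w' : EuclideanSpace ℝ (Fin (n + 1))} {b b' τ s : ℝ}
    (hs : 0 < s) (hsw : s ≤ ‖w + w'‖) (hτ0 : 0 ≤ τ)
    (hτ : ∀ x, |margin w b x - margin w' b' x| ≤ τ) :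
    err (uniform (n + 1)) (halfSpace w' b') (halfSpace w b) ≤
      2 * (τ / s) * ballVol n / ballVol (n + 1) := by
  have hp := ballVol_pos (n + 1)
  have hp' := ballVol_pos n
  have hpos : 0 < ‖w + w'‖ := hs.trans_le hsw
  set e := (‖w + w'‖)⁻¹ • (w + w') with he
  have hen : ‖e‖ = 1 := by
    rw [he, norm_smul, norm_inv, norm_norm, inv_mul_cancel₀ hpos.ne']
  have hsub : {x | ¬ (x ∈ halfSpace w b ↔ x ∈ halfSpace w' b')} ⊆
      {x : HalfBall (n + 1) | |inner ℝ e x.1 - (b + b') / ‖w + w'‖| ≤ τ / s} := by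
    intro x hx
    have h1 : |margin w b x + margin w' b' x| ≤ τ := by
      refine le_trans ?_ (hτ x)
      rw [mem_ofPred_eq, mem_halfSpace, mem_halfSpace] at hx
      rcases le_or_gt 0 (margin w b x) with h1 | h1 <;>
      rcases le_or_gt 0 (margin w' b' x) with h2 | h2
      · exact absurd (iff_of_true h1 h2) hx
      · rw [abs_of_nonneg (by linarith : 0 ≤ margin w b x - margin w' b' x), abs_le]
        constructor <;> linarith
      · rw [abs_of_nonpos (by linarith : margin w b x - margin w' b' x ≤ 0), abs_le]
        constructor <;> linarith
      · exact absurd (iff_of_false (by linarith) (by linarith)) hx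
    have h2 : inner ℝ e x.1 - (b + b') / ‖w + w'‖ =
        (margin w b x + margin w' b' x) / ‖w + w'‖ := by
      rw [he, real_inner_smul_left, inner_add_left, margin, margin]
      field_simp
      ring
    rw [mem_ofPred_eq, h2, abs_div, abs_of_pos hpos]
    exact div_le_div₀ hτ0 h1 hs hsw
  have h := (measure_mono hsub).trans
    (uniform_slab_le e hen ((b + b') / ‖w + w'‖) (τ / s) (by positivity))
  exact ENNReal.toReal_le_of_le_ofReal (by positivity) h

/-- The feet differ by `m • w - m' • w'`, whose squared norm is `(m - m') ^ 2 + m * m' * ‖w - w'‖ ^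
2`. As `m * m' > 0`, both terms are controlled. -/
lemma normal_and_offset_close {k : ℕ} {w w' : EuclideanSpace ℝ (Fin k)} {b b' κ : ℝ}
    (hw : ‖w‖ = 1) (hw' : ‖w'‖ = 1) {y : HalfBall k} (hκ : 0 ≤ κ)
    (hpos : 0 < margin w b y * margin w' b' y)
    (hclose : dist (foot w b y) (foot w' b' y) ≤ κ * (|margin w b y| + |margin w' b' y|)) :
    ‖w - w'‖ ≤ 2 * κ ∧
      |margin w b y - margin w' b' y| ≤ κ * (|margin w b y| + |margin w' b' y|) := by
  set m := margin w b y
  set m' := margin w' b' y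
  have hmm : |m| * |m'| = m * m' := by rw [← abs_mul, abs_of_pos hpos]
  have hsum : 0 < |m| + |m'| := by
    have : m ≠ 0 := fun h => by simp [h] at hpos
    positivity
  have h1 : ‖m • w - m' • w'‖ ≤ κ * (|m| + |m'|) := by
    rw [dist_eq_norm, foot, foot, ← norm_neg] at hclose
    have : m • w - m' • w' = -(y.1 - m • w - (y.1 - m' • w')) := by abel
    rwa [this]
  have h2 : ‖m • w - m' • w'‖ ^ 2 = m ^ 2 + m' ^ 2 - 2 * (m * m') * inner ℝ w w' := by
    rw [norm_sub_sq_real, norm_smul, norm_smul, hw, hw', real_inner_smul_left,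
      real_inner_smul_right]
    simp only [mul_one, Real.norm_eq_abs, sq_abs]
    ring
  have h3 : ‖w - w'‖ ^ 2 = 2 - 2 * inner ℝ w w' := by
    rw [norm_sub_sq_real, hw, hw']
    ring
  have hi : inner ℝ w w' ≤ 1 := by
    have := real_inner_le_norm w w'
    rwa [hw, hw', one_mul] at this
  have hi' : -1 ≤ inner ℝ w w' := by
    have := neg_le_of_abs_le (abs_real_inner_le_norm w w')
    rwa [hw, hw', one_mul] at this
  have h4 : (κ * (|m| + |m'|)) ^ 2 ≥ m ^ 2 + m' ^ 2 - 2 * (m * m') * inner ℝ w w' := by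
    rw [← h2]
    gcongr
  constructor
  · refine le_of_sq_le_sq ?_ (by positivity)
    have h5 : (‖w - w'‖ * (|m| + |m'|)) ^ 2 ≤ (2 * κ * (|m| + |m'|)) ^ 2 := by
      have : (|m| + |m'|) ^ 2 = m ^ 2 + m' ^ 2 + 2 * (m * m') := by
        rw [add_sq, sq_abs, sq_abs, mul_assoc, hmm]
        ring
      rw [mul_pow, h3]
      -- Twice this quantity is exactly the slack: `4 * ‖m • w - m' • w'‖ ^ 2 - ‖w - w'‖ ^ 2 * (|m|
      -- + |m'|) ^ 2`.
      have h6 : 0 ≤ (m - m') ^ 2 * (1 + inner ℝ w w') :=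
        mul_nonneg (sq_nonneg _) (by linarith)
      have h7 : (2 * κ * (|m| + |m'|)) ^ 2 = 4 * (κ * (|m| + |m'|)) ^ 2 := by ring
      rw [h7, this]
      nlinarith
    rw [mul_pow, mul_pow _ (|m| + |m'|)] at h5
    exact le_of_mul_le_mul_right h5 (by positivity)
  · refine abs_le_of_sq_le_sq ?_ (by positivity)
    nlinarith [mul_nonneg hpos.le (by linarith : 0 ≤ 1 - inner ℝ w w')]

lemma abs_margin_sub_margin_le {k : ℕ} {w w' : EuclideanSpace ℝ (Fin k)} {b b' : ℝ}
    (x y : HalfBall k) :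
    |margin w b x - margin w' b' x| ≤ ‖w - w'‖ + |margin w b y - margin w' b' y| := by
  have h : margin w b x - margin w' b' x =
      inner ℝ (w - w') (x.1 - y.1) + (margin w b y - margin w' b' y) := by
    simp only [margin, inner_sub_left, inner_sub_right]
    ring
  rw [h]
  refine (abs_add_le _ _).trans (add_le_add_left ?_ _)
  refine (abs_real_inner_le_norm _ _).trans ?_
  have h1 : ‖x.1 - y.1‖ ≤ 1 := by
    linarith [norm_sub_le x.1 y.1, x.norm_le, y.norm_le]
  nlinarith [norm_nonneg (w - w')]

lemma eq_of_unit_of_norm_sub_lt {w w' : EuclideanSpace ℝ (Fin 1)} (hw : ‖w‖ = 1) (hw' : ‖w'‖ = 1)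
    (h : ‖w - w'‖ < 2) : w = w' := by
  have key : ∀ v : EuclideanSpace ℝ (Fin 1), ‖v‖ = |v 0| := fun v => by
    simp [EuclideanSpace.norm_eq, Real.sqrt_sq_eq_abs]
  rw [key] at hw hw' h
  ext i
  rw [Subsingleton.elim i 0]
  simp only [PiLp.sub_apply] at h
  rcases (abs_eq zero_le_one).1 hw with h1 | h1 <;> rcases (abs_eq zero_le_one).1 hw' with h2 | h2
  · rw [h1, h2]
  · rw [h1, h2] at h
    norm_num at h
  · rw [h1, h2] at h
    norm_num at h
  · rw [h1, h2]

theorem err_halfSpace_le {n : ℕ} {w w' : EuclideanSpace ℝ (Fin (n + 1))} {b b' ε μ : ℝ}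
    (hw : ‖w‖ = 1) (hw' : ‖w'‖ = 1) (hε : 0 < ε) (hε1 : ε ≤ 1) (hμ : μ ≤ 27 / 128)
    {y : HalfBall (n + 1)}
    (hpos : 0 < margin w b y * margin w' b' y)
    (hm : |margin w b y| ≤ μ) (hm' : |margin w' b' y| ≤ μ)
    (hclose : dist (foot w b y) (foot w' b' y) ≤
      3 / 5 * (ε / 2 ^ n) * (|margin w b y| + |margin w' b' y|)) :
    err (uniform (n + 1)) (halfSpace w' b') (halfSpace w b) ≤ ε := by
  set η := ε / 2 ^ n with hη
  have hη0 : 0 < η := by positivity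
  obtain ⟨h1, h2⟩ := normal_and_offset_close hw hw' (by positivity) hpos hclose
  have hμ0 : 0 ≤ μ := (abs_nonneg _).trans hm
  have h3 : |margin w b y - margin w' b' y| ≤ 3 / 5 * η * (2 * (27 / 128)) :=
    h2.trans (by gcongr; linarith)
  -- On the line the normals are `±1`, so closeness makes them equal. The general case needs `η ≤ 1
  -- / 2`, which is available only from dimension two on.
  rcases n with _ | n
  · have hηε : η = ε := by rw [hη]; simp
    rw [hηε] at h1 h3
    have hww : w = w' := eq_of_unit_of_norm_sub_lt hw hw' (by linarith)
    subst hww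
    have h := err_halfSpace_le_slab (w := w) (w' := w) (b := b) (b' := b')
      (τ := 3 / 5 * ε * (2 * (27 / 128))) (s := 2)
      (by norm_num) (by rw [← two_smul ℝ w, norm_smul, hw]; norm_num) (by positivity) (fun x => by
        refine (abs_margin_sub_margin_le x y).trans ?_
        simpa using h3)
    rw [ballVol_zero, show ballVol (0 + 1) = 1 from ballVol_one] at h
    linarith
  · have hη2 : η ≤ 1 / 2 := by
      rw [hη, div_le_iff₀ (by positivity), pow_succ]
      have : (1 : ℝ) ≤ 2 ^ n := one_le_pow₀ (by norm_num)
      linarith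
    -- Here `‖w - w'‖ ≤ 3 / 5`, so `‖w + w'‖ ^ 2 ≥ 4 - 0.36 = 3.64 > 1.9 ^ 2`.
    have hs : 19 / 10 ≤ ‖w + w'‖ := by
      have h4 := parallelogram_law_with_norm ℝ w w'
      rw [hw, hw'] at h4
      refine le_of_sq_le_sq ?_ (norm_nonneg _)
      nlinarith [norm_nonneg (w - w')]
    have h := err_halfSpace_le_slab (w := w) (w' := w') (b := b) (b' := b')
      (τ := 2 * (3 / 5 * η) + 3 / 5 * η * (2 * (27 / 128))) (s := 19 / 10)
      (by norm_num) hs (by positivity) (fun x => by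
        refine (abs_margin_sub_margin_le x y).trans (add_le_add h1 h3))
    refine h.trans ?_
    have hp := ballVol_pos (n + 1 + 1)
    have hv := (ballVol_ratio n).1
    rw [div_le_iff₀ hp]
    have hε' : ε = η * 2 ^ (n + 1) := by rw [hη]; field_simp
    calc _ ≤ 2 * ((2 * (3 / 5 * η) + 3 / 5 * η * (2 * (27 / 128))) / (19 / 10)) *
          (2 ^ (n + 2) / Real.pi * ballVol (n + 2)) := by gcongr
      _ = (2 * (2 * (3 / 5) + 3 / 5 * (2 * (27 / 128))) / (19 / 10) * 2 / Real.pi) *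
          (ε * ballVol (n + 1 + 1)) := by rw [hε']; ring
      -- The numerator is about 3.06, just below `π`; the constants 3/5 and 27/128 leave room for
      -- this.
      _ ≤ 1 * (ε * ballVol (n + 1 + 1)) := by
          gcongr
          rw [div_le_one Real.pi_pos]
          linarith [Real.pi_gt_d2]
      _ = _ := one_mul _

/-! ### The boundary inside the ball -/

/-- The part of the hyperplane `⟨w, ·⟩ = b` inside the ball. -/
def boundary {k : ℕ} (w : EuclideanSpace ℝ (Fin k)) (b : ℝ) : Set (HalfBall k) :=
  {x | margin w b x = 0}

/-- The distance of `x` from the hyperplane `⟨w, ·⟩ = b` within the ball. -/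
noncomputable def gap {k : ℕ} (w : EuclideanSpace ℝ (Fin k)) (b : ℝ) (x : HalfBall k) : ℝ :=
  Metric.infDist x (boundary w b)

section Geometry

variable {k : ℕ} {w : EuclideanSpace ℝ (Fin k)} {b : ℝ}

lemma continuous_margin : Continuous (margin w b) := by
  unfold margin
  fun_prop

lemma isClosed_boundary : IsClosed (boundary w b) :=
  isClosed_singleton.preimage (t := {(0 : ℝ)}) continuous_margin

lemma continuous_gap : Continuous (gap w b) := Metric.continuous_infDist_pt _

lemma gap_nonneg (x : HalfBall k) : 0 ≤ gap w b x := Metric.infDist_nonneg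

lemma gap_le_dist {x y : HalfBall k} (hy : margin w b y = 0) : gap w b x ≤ dist x y :=
  Metric.infDist_le_dist_of_mem hy

lemma dist_le_one (x y : HalfBall k) : dist x y ≤ 1 := by
  rw [Subtype.dist_eq, dist_eq_norm]
  linarith [norm_sub_le x.1 y.1, x.norm_le, y.norm_le]

lemma exists_between (w : EuclideanSpace ℝ (Fin k)) (b : ℝ) (x y : HalfBall k) {t : ℝ} (ht0 : 0 ≤ t)
    (ht1 : t ≤ 1) :
    ∃ z : HalfBall k, margin w b z = (1 - t) * margin w b x + t * margin w b y ∧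
      dist x z = t * dist x y ∧ dist z y = (1 - t) * dist x y := by
  refine ⟨⟨(1 - t) • x.1 + t • y.1, ?_⟩, ?_, ?_, ?_⟩
  · exact convex_closedBall _ _ x.2 y.2 (by linarith) ht0 (by ring)
  · simp only [margin, inner_add_right, real_inner_smul_right]
    ring
  · rw [Subtype.dist_eq, Subtype.dist_eq, dist_eq_norm, dist_eq_norm]
    have : x.1 - ((1 - t) • x.1 + t • y.1) = t • (x.1 - y.1) := by module
    rw [this, norm_smul, Real.norm_of_nonneg ht0]
  · rw [Subtype.dist_eq, Subtype.dist_eq, dist_eq_norm, dist_eq_norm]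
    have : (1 - t) • x.1 + t • y.1 - y.1 = (1 - t) • (x.1 - y.1) := by module
    rw [this, norm_smul, Real.norm_of_nonneg (by linarith)]

lemma exists_crossing {x y : HalfBall k} (h : margin w b x * margin w b y ≤ 0) :
    ∃ z, margin w b z = 0 ∧ dist x z + dist z y = dist x y := by
  rcases eq_or_ne (margin w b x) 0 with hx | hx
  · exact ⟨x, hx, by simp⟩
  have hd : (margin w b x - margin w b y) * margin w b x > 0 := by
    have := sq_pos_of_pos (abs_pos.2 hx)
    rw [sq_abs] at this
    nlinarith
  have hne : margin w b x - margin w b y ≠ 0 := fun h0 => by simp [h0] at hd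
  set t := margin w b x / (margin w b x - margin w b y) with ht
  have ht0 : 0 ≤ t := by
    rw [ht, ← mul_div_mul_right _ _ hx]
    exact div_nonneg (mul_self_nonneg _) hd.le
  have ht1 : t ≤ 1 := by
    rw [ht, ← mul_div_mul_right _ _ hx, div_le_one hd]
    nlinarith
  obtain ⟨z, hz, h1, h2⟩ := exists_between w b x y ht0 ht1
  refine ⟨z, ?_, by rw [h1, h2]; ring⟩
  rw [hz, ht]
  field_simp
  ring

lemma gap_le_of_opposite {x y : HalfBall k} (h : margin w b x * margin w b y ≤ 0) :
    gap w b x ≤ dist x y := by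
  obtain ⟨z, hz, hd⟩ := exists_crossing h
  linarith [gap_le_dist (x := x) hz, dist_nonneg (x := z) (y := y)]

lemma abs_margin_sub_le (hw : ‖w‖ = 1) (x y : HalfBall k) :
    |margin w b x - margin w b y| ≤ dist x y := by
  have : margin w b x - margin w b y = inner ℝ w (x.1 - y.1) := by
    rw [margin, margin, inner_sub_right]
    ring
  rw [this, Subtype.dist_eq, dist_eq_norm]
  simpa [hw] using abs_real_inner_le_norm w (x.1 - y.1)

lemma gap_le_one (hne : (boundary w b).Nonempty) (x : HalfBall k) : gap w b x ≤ 1 := by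
  obtain ⟨z, hz⟩ := hne
  exact (gap_le_dist hz).trans (dist_le_one _ _)

lemma gap_eq_zero_iff (hne : (boundary w b).Nonempty) {x : HalfBall k} :
    gap w b x = 0 ↔ margin w b x = 0 :=
  (isClosed_boundary.mem_iff_infDist_zero hne).symm

end Geometry

/-! ### What an admissible oracle guarantees -/

/-- What the analysis uses about the oracle `D` for the target `⟨w, ·⟩ ≥ b`: the contrastive
example is not strictly on the same side, and it is close to the nearest boundary point with
probability bounded below by Markov's inequality. -/
structure IsBoundaryOracle {k : ℕ} (f : ℝ≥0 → ℝ≥0) (w : EuclideanSpace ℝ (Fin k)) (b : ℝ)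
    (D : Kernel (HalfBall k) (HalfBall k)) : Prop where
  nonempty : (boundary w b).Nonempty
  markov : IsMarkovKernel D
  side : ∀ x, ∀ᵐ x' ∂(D x),
    (x ∈ halfSpace w b → margin w b x' ≤ 0) ∧ (x ∉ halfSpace w b → 0 ≤ margin w b x')
  close : ∀ x, ∃ xm, margin w b xm = 0 ∧ dist x xm = gap w b x ∧ ∀ t : ℝ, 0 < t →
    D x {x' | ¬ dist x' xm ≤ t * f (gap w b x).toNNReal} ≤ ENNReal.ofReal t⁻¹

lemma measure_not_dist_le {X : Type*} [MetricSpace X] [MeasurableSpace X] [BorelSpace X]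
    [SecondCountableTopology X] {μ : Measure X} {z : X} {c : ℝ≥0}
    (h : ∫⁻ x, edist x z ∂μ ≤ c) {t : ℝ} (ht : 0 < t) :
    μ {x | ¬ dist x z ≤ t * c} ≤ ENNReal.ofReal t⁻¹ := by
  have hm : Measurable fun x => edist x z := by fun_prop
  -- For `c = 0` Markov's inequality at threshold zero is void; the integral vanishes and `x = z`
  -- almost surely.
  rcases eq_or_ne c 0 with rfl | hc
  · have h0 : ∫⁻ x, edist x z ∂μ = 0 := le_antisymm (by simpa using h) zero_le
    rw [lintegral_eq_zero_iff hm] at h0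
    have : μ {x | ¬ dist x z ≤ t * (0 : ℝ≥0)} = 0 := by
      rw [← compl_ofPred, ← mem_ae_iff]
      filter_upwards [h0] with x hx
      simpa using hx
    rw [this]
    exact zero_le
  · have hc' : 0 < (c : ℝ) := by exact_mod_cast pos_iff_ne_zero.2 hc
    have h1 := (mul_meas_ge_le_lintegral hm (ENNReal.ofReal (t * c))).trans h
    have hsub : {x | ¬ dist x z ≤ t * c} ⊆ {x | ENNReal.ofReal (t * c) ≤ edist x z} := by
      intro x hx
      rw [mem_ofPred_eq, edist_dist]
      exact ENNReal.ofReal_le_ofReal (not_le.1 hx).le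
    refine (measure_mono hsub).trans ?_
    rw [mul_comm, ← ENNReal.le_div_iff_mul_le (Or.inl (by simpa using by positivity))
      (Or.inl ENNReal.ofReal_ne_top)] at h1
    refine h1.trans (le_of_eq ?_)
    rw [show (c : ℝ≥0∞) = ENNReal.ofReal c by simp, ← ENNReal.ofReal_div_of_pos (by positivity)]
    congr 1
    field_simp

/-- Both labels occur, so the hyperplane meets the ball, and each of its points in the ball is a
limit of points of either label. An ideal contrastive example is thus a nearest boundary point, and
the mean condition becomes a tail bound. -/
lemma isBoundaryOracle_of_mem {k : ℕ} {f : ℝ≥0 → ℝ≥0} {w : EuclideanSpace ℝ (Fin k)} {b : ℝ}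
    {D : Kernel (HalfBall k) (HalfBall k)} (hD : D ∈ probAMDM f (halfSpace w b)) :
    IsBoundaryOracle f w b D := by
  obtain ⟨hmk, hD⟩ := hD
  have hopp : ∀ x : HalfBall k, (oppositeLabel (halfSpace w b) x).Nonempty := fun x => by
    obtain ⟨-, xm, hxm, -⟩ := hD x
    exact closure_nonempty_iff.1 ⟨xm, hxm.1⟩
  have hin : ∃ p : HalfBall k, 0 ≤ margin w b p ∧ ∃ q : HalfBall k, margin w b q < 0 := by
    obtain ⟨x0⟩ : Nonempty (HalfBall k) := ⟨⟨0, by simp⟩⟩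
    obtain ⟨y, hy⟩ := hopp x0
    rw [oppositeLabel, mem_ofPred_eq, mem_halfSpace, mem_halfSpace] at hy
    rcases le_or_gt 0 (margin w b x0) with h0 | h0
    · exact ⟨x0, h0, y, not_le.1 fun h => hy (iff_of_true h h0)⟩
    · exact ⟨y, not_lt.1 fun h => hy (iff_of_false (by linarith) (by linarith)), x0, h0⟩
  obtain ⟨p, hp, q, hq⟩ := hin
  have hne : (boundary w b).Nonempty := by
    obtain ⟨z, hz, -⟩ := exists_crossing (mul_nonpos_of_nonneg_of_nonpos hp hq.le)
    exact ⟨z, hz⟩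
  have hcl1 : ∀ x ∈ halfSpace w b, closure (oppositeLabel (halfSpace w b) x) ⊆
      {y | margin w b y ≤ 0} := fun x hx =>
    closure_minimal (fun y hy => by
      rw [oppositeLabel, mem_ofPred_eq, iff_true_right hx, mem_halfSpace, not_le] at hy
      exact hy.le) (isClosed_Iic.preimage (t := Iic (0 : ℝ)) continuous_margin)
  have hcl2 : ∀ x ∉ halfSpace w b, closure (oppositeLabel (halfSpace w b) x) ⊆
      {y | 0 ≤ margin w b y} := fun x hx =>
    closure_minimal (fun y hy => by
      rw [oppositeLabel, mem_ofPred_eq, iff_false_right hx, not_not, mem_halfSpace] at hy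
      exact hy) (isClosed_Ici.preimage (t := Ici (0 : ℝ)) continuous_margin)
  have hbd : ∀ x, boundary w b ⊆ closure (oppositeLabel (halfSpace w b) x) := by
    intro x z hz
    by_cases hx : x ∈ halfSpace w b
    -- Boundary points carry the positive label, so for a positive `x` they are only limits of
    -- negative points, reached along the segment towards `q`.
    · rw [Metric.mem_closure_iff]
      intro ε hε
      set t := min 1 (ε / 2) with ht
      have ht0 : 0 < t := by positivity
      obtain ⟨y, hy, hy1, -⟩ := exists_between w b z q ht0.le (min_le_left _ _)
      refine ⟨y, ?_, ?_⟩
      · rw [oppositeLabel, mem_ofPred_eq, iff_true_right hx, mem_halfSpace, not_le, hy,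
          show margin w b z = 0 from hz]
        nlinarith
      · rw [hy1]
        calc t * dist z q ≤ ε / 2 * 1 := by
              gcongr
              · exact min_le_right _ _
              · exact dist_le_one _ _
          _ < ε := by linarith
    · refine subset_closure ?_
      rw [oppositeLabel, mem_ofPred_eq, iff_false_right hx, not_not, mem_halfSpace]
      exact (show margin w b z = 0 from hz).ge
  have hside : ∀ x, ∀ x' ∈ closure (oppositeLabel (halfSpace w b) x),
      (x ∈ halfSpace w b → margin w b x' ≤ 0) ∧ (x ∉ halfSpace w b → 0 ≤ margin w b x') :=
    fun x x' hx' => ⟨fun h => hcl1 x h hx', fun h => hcl2 x h hx'⟩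
  refine ⟨hne, hmk, fun x => ?_, fun x => ?_⟩
  · filter_upwards [(hD x).1] with x' hx'
    exact hside x x' (hx'.elim (fun h => subset_closure h) (fun h => h.1))
  · obtain ⟨-, xm, hxm, hint⟩ := hD x
    have hop : margin w b x * margin w b xm ≤ 0 := by
      obtain ⟨h1, h2⟩ := hside x xm hxm.1
      by_cases hx : x ∈ halfSpace w b
      · exact mul_nonpos_of_nonneg_of_nonpos (mem_halfSpace.1 hx) (h1 hx)
      · have := h2 hx
        rw [mem_halfSpace, not_le] at hx
        exact mul_nonpos_of_nonpos_of_nonneg hx.le this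
    have h0 : margin w b xm = 0 := by
      -- The segment from `x` to `xm` crosses the boundary at a point that is no nearer than `xm`,
      -- hence equals `xm`.
      obtain ⟨z, hz, hd⟩ := exists_crossing hop
      have h1 := hxm.2 z (hbd x hz)
      have h2 : dist z xm = 0 := le_antisymm (by linarith) dist_nonneg
      rw [← dist_eq_zero.1 h2]
      exact hz
    have hgap : dist x xm = gap w b x :=
      le_antisymm ((Metric.le_infDist hne).2 fun {y} hy => hxm.2 y (hbd x hy)) (gap_le_dist h0)
    refine ⟨xm, h0, hgap, fun t ht => ?_⟩
    have : (gap w b x).toNNReal = nndist x xm := by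
      rw [← hgap, dist_nndist, Real.toNNReal_coe]
    rw [this]
    exact measure_not_dist_le hint ht

namespace IsBoundaryOracle

variable {k : ℕ} {f : ℝ≥0 → ℝ≥0} {w : EuclideanSpace ℝ (Fin k)} {b : ℝ}
  {D : Kernel (HalfBall k) (HalfBall k)}

lemma opposite (hD : IsBoundaryOracle f w b D) (x : HalfBall k) :
    ∀ᵐ x' ∂(D x), margin w b x * margin w b x' ≤ 0 := by
  filter_upwards [hD.side x] with x' h
  by_cases hx : x ∈ halfSpace w b
  · exact mul_nonpos_of_nonneg_of_nonpos (mem_halfSpace.1 hx) (h.1 hx)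
  · have := h.2 hx
    rw [mem_halfSpace, not_le] at hx
    exact mul_nonpos_of_nonpos_of_nonneg hx.le this

/-- With the constant `2` in Markov's inequality, the contrastive example is near the boundary. -/
lemma gap_contrastive (hD : IsBoundaryOracle f w b D) (x : HalfBall k) :
    D x {x' | ¬ gap w b x' ≤ 2 * f (gap w b x).toNNReal} ≤ 2⁻¹ := by
  obtain ⟨xm, h0, -, h⟩ := hD.close x
  have hsub : {x' | ¬ gap w b x' ≤ 2 * f (gap w b x).toNNReal} ⊆
      {x' | ¬ dist x' xm ≤ 2 * f (gap w b x).toNNReal} :=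
    fun x' hx' hd => hx' ((gap_le_dist h0).trans hd)
  refine (measure_mono hsub).trans ((h 2 two_pos).trans (le_of_eq ?_))
  rw [ENNReal.ofReal_inv_of_pos two_pos, ENNReal.ofReal_ofNat]

/-- With the constant `2` in Markov's inequality, the contrastive example is near the query. -/
lemma dist_contrastive (hD : IsBoundaryOracle f w b D) (x : HalfBall k) :
    D x {x' | ¬ dist x x' ≤ gap w b x + 2 * f (gap w b x).toNNReal} ≤ 2⁻¹ := by
  obtain ⟨xm, -, hg, h⟩ := hD.close x
  have hsub : {x' | ¬ dist x x' ≤ gap w b x + 2 * f (gap w b x).toNNReal} ⊆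
      {x' | ¬ dist x' xm ≤ 2 * f (gap w b x).toNNReal} := by
    intro x' hx' hd
    refine hx' ?_
    linarith [dist_triangle x xm x', dist_comm x' xm]
  refine (measure_mono hsub).trans ((h 2 two_pos).trans (le_of_eq ?_))
  rw [ENNReal.ofReal_inv_of_pos two_pos, ENNReal.ofReal_ofNat]

lemma contrastive_eq (hD : IsBoundaryOracle f w b D) (hf : f 0 = 0) {x : HalfBall k}
    (hx : margin w b x = 0) : ∀ᵐ x' ∂(D x), x' = x := by
  obtain ⟨xm, h0, hg, h⟩ := hD.close x
  have hgap := (gap_eq_zero_iff hD.nonempty).2 hx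
  rw [hgap, dist_eq_zero] at hg
  subst hg
  rw [ae_iff]
  refine le_antisymm (ENNReal.le_of_forall_pos_le_add fun ε hε _ => ?_) zero_le
  -- The radius `t * f 0` is zero for every `t`, so the failure probability `t⁻¹` may be taken
  -- arbitrarily small.
  have := h (ε : ℝ)⁻¹ (by positivity)
  rw [hgap, Real.toNNReal_zero, hf, inv_inv] at this
  simpa using this

/-- If the orthogonal projection of `x` to the hyperplane lies in the ball, the contrastive example
is close to it. -/
lemma dist_foot (hD : IsBoundaryOracle f w b D) (hw : ‖w‖ = 1) {x : HalfBall k}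
    (hx : ‖foot w b x‖ ≤ 1 / 2) {t : ℝ} (ht : 0 < t) :
    D x {x' | ¬ dist x'.1 (foot w b x) ≤ t * f ‖margin w b x‖₊} ≤ ENNReal.ofReal t⁻¹ := by
  obtain ⟨xm, h0, hg, h⟩ := hD.close x
  let p : HalfBall k := ⟨foot w b x, mem_closedBall_zero_iff.2 hx⟩
  have hip : ∀ v : EuclideanSpace ℝ (Fin k), inner ℝ w (v - margin w b x • w) =
      inner ℝ w v - margin w b x := fun v => by
    rw [inner_sub_right, real_inner_smul_right, real_inner_self_eq_norm_sq, hw]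
    ring
  have hp : margin w b p = 0 := by
    change inner ℝ w (x.1 - margin w b x • w) - b = 0
    rw [hip, margin]
    ring
  have hxp : dist x p = |margin w b x| := by
    rw [Subtype.dist_eq, dist_eq_norm]
    change ‖x.1 - (x.1 - margin w b x • w)‖ = _
    rw [sub_sub_cancel, norm_smul, hw, mul_one, Real.norm_eq_abs]
  have hle : dist x xm ≤ |margin w b x| := by
    rw [hg, ← hxp]
    exact gap_le_dist hp
  -- By Pythagoras, the foot is the only boundary point at distance at most `|margin w b x|` from
  -- `x`.
  have hpm : xm = p := by
    have h1 : ‖x.1 - xm.1‖ ^ 2 = margin w b x ^ 2 + ‖p.1 - xm.1‖ ^ 2 := by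
      have h2 : x.1 - xm.1 = margin w b x • w + (p.1 - xm.1) := by
        change _ = margin w b x • w + (x.1 - margin w b x • w - xm.1)
        abel
      have h3 : inner ℝ w (p.1 - xm.1) = 0 := by
        rw [inner_sub_right]
        simp only [margin] at hp h0
        linarith
      rw [h2, norm_add_sq_real, norm_smul, hw, real_inner_smul_left, h3, mul_one,
        Real.norm_eq_abs, sq_abs]
      ring
    rw [Subtype.dist_eq, dist_eq_norm] at hle
    have h4 : ‖x.1 - xm.1‖ ^ 2 ≤ margin w b x ^ 2 := by
      rw [← sq_abs (margin w b x)]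
      gcongr
    have h5 : ‖p.1 - xm.1‖ ^ 2 = 0 := le_antisymm (by linarith) (sq_nonneg _)
    rw [pow_eq_zero_iff two_ne_zero, norm_eq_zero, sub_eq_zero] at h5
    exact (Subtype.ext h5).symm
  have hn : (gap w b x).toNNReal = ‖margin w b x‖₊ := by
    rw [← hg, hpm, hxp]
    ext
    simp
  have := h t ht
  rw [hn, hpm] at this
  exact this

end IsBoundaryOracle

/-! ### Expectations along a run of a learner -/

section Run

variable {X : Type*} [MeasurableSpace X] {𝒞 : Set (Set X)} (A : ActiveLearner X 𝒞) {ℓ : Set X}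
  (D : Kernel X X)

lemma measurable_extend {α : Type*} [MeasurableSpace α] (hℓ : MeasurableSet ℓ) {n : ℕ}
    {h : α → History X n} {x x' : α → X} (hh : Measurable h) (hx : Measurable x)
    (hx' : Measurable x') : Measurable fun a => extend ℓ (h a) (x a) (x' a) := by
  refine measurable_pi_iff.2 fun i => ?_
  have hmem : Measurable fun z : X => z ∈ ℓ := measurable_mem.2 hℓ
  induction i using Fin.lastCases with
  | last =>
    simp only [extend, Fin.snoc_last]
    exact (hx.prodMk (hmem.comp hx)).prodMk (hx'.prodMk (hmem.comp hx'))
  | cast i =>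
    simp only [extend, Fin.snoc_castSucc]
    exact (measurable_pi_apply i).comp hh

lemma measurable_extend_step (hℓ : MeasurableSet ℓ) (n : ℕ) :
    Measurable fun q : (A.Seed × History X n) × X =>
      ((q.1.1, extend ℓ q.1.2 (A.query n q.1) q.2) : A.Seed × History X (n + 1)) :=
  (measurable_fst.comp measurable_fst).prodMk (measurable_extend hℓ
    (measurable_snd.comp measurable_fst) ((A.measurable_query n).comp measurable_fst)
    measurable_snd)

lemma isProbabilityMeasure_run [IsMarkovKernel D] (hℓ : MeasurableSet ℓ) (n : ℕ) :
    IsProbabilityMeasure (run A ℓ D n) := by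
  induction n with
  | zero =>
    exact Measure.isProbabilityMeasure_map (by fun_prop)
  | succ n ih =>
    exact Measure.isProbabilityMeasure_map (measurable_extend_step A hℓ n).aemeasurable

lemma lintegral_run_zero {Φ : A.Seed × History X 0 → ℝ≥0∞} (hΦ : Measurable Φ) :
    ∫⁻ p, Φ p ∂(run A ℓ D 0) = ∫⁻ s, Φ (s, Fin.elim0) ∂A.seedLaw := by
  rw [run, lintegral_map hΦ (by fun_prop)]

lemma lintegral_run_succ [IsMarkovKernel D] (hℓ : MeasurableSet ℓ) {n : ℕ}
    {Φ : A.Seed × History X (n + 1) → ℝ≥0∞} (hΦ : Measurable Φ) :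
    ∫⁻ p, Φ p ∂(run A ℓ D (n + 1)) =
      ∫⁻ p, ∫⁻ x', Φ (p.1, extend ℓ p.2 (A.query n p) x') ∂(D (A.query n p))
        ∂(run A ℓ D n) := by
  have := isProbabilityMeasure_run A D hℓ n
  rw [run, lintegral_map hΦ (measurable_extend_step A hℓ n)]
  exact Measure.lintegral_compProd (hΦ.comp (measurable_extend_step A hℓ n))

/-- If the conditional expectation of a potential after a query is at most `c` times its value
before the query, then so are the expectations. -/
lemma lintegral_run_succ_le [IsMarkovKernel D] (hℓ : MeasurableSet ℓ) {n : ℕ} {c : ℝ≥0∞} (hc : c ≠ ∞)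
    {Φ : A.Seed × History X n → ℝ≥0∞} {Φ' : A.Seed × History X (n + 1) → ℝ≥0∞}
    (hΦ' : Measurable Φ')
    (h : ∀ p, ∫⁻ x', Φ' (p.1, extend ℓ p.2 (A.query n p) x') ∂(D (A.query n p)) ≤ c * Φ p) :
    ∫⁻ p, Φ' p ∂(run A ℓ D (n + 1)) ≤ c * ∫⁻ p, Φ p ∂(run A ℓ D n) := by
  rw [lintegral_run_succ A D hℓ hΦ', ← lintegral_const_mul' _ _ hc]
  exact lintegral_mono h

end Run

/-- A function that is at most `a` on a set and at most `a + c` off it. -/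
lemma lintegral_le_of_ae_le_of_measure_le {X : Type*} [MeasurableSpace X] {μ : Measure X}
    [IsProbabilityMeasure μ] {φ : X → ℝ≥0∞} {G : X → Prop} {a c q : ℝ≥0∞}
    (hG : μ {x | ¬ G x} ≤ q) (h1 : ∀ᵐ x ∂μ, G x → φ x ≤ a) (h2 : ∀ᵐ x ∂μ, φ x ≤ a + c) :
    ∫⁻ x, φ x ∂μ ≤ a + c * q := by
  calc ∫⁻ x, φ x ∂μ ≤ ∫⁻ x, (a + {x | ¬ G x}.indicator (fun _ => c) x) ∂μ := by
        refine lintegral_mono_ae ?_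
        filter_upwards [h1, h2] with x h1 h2
        by_cases hx : G x
        · rw [indicator_of_notMem (by simpa using hx), add_zero]
          exact h1 hx
        · rw [indicator_of_mem (by simpa using hx)]
          exact h2
    _ = a + ∫⁻ x, {x | ¬ G x}.indicator (fun _ => c) x ∂μ := by
        rw [lintegral_add_left measurable_const]
        simp
    _ ≤ a + c * q := by
        gcongr
        exact (lintegral_indicator_const_le _ _).trans (by gcongr)

/-! ### The learner -/

/-- The origin, as a point of the ball. -/
def center (k : ℕ) : HalfBall k := ⟨0, by simp⟩

/-- The dilation by `t ∈ [0, 1]`; other factors `t` are replaced by the nearest one in `[0, 1]`. -/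
noncomputable def shrink {k : ℕ} (t : ℝ) (x : HalfBall k) : HalfBall k :=
  ⟨(projIcc 0 1 zero_le_one t : ℝ) • x.1, by
    have h := (projIcc (0 : ℝ) 1 zero_le_one t).2
    rw [mem_closedBall_zero_iff, norm_smul, Real.norm_of_nonneg h.1]
    nlinarith [x.norm_le, norm_nonneg x.1, h.1, h.2]⟩

lemma coe_shrink {k : ℕ} {t : ℝ} (h0 : 0 ≤ t) (h1 : t ≤ 1) (x : HalfBall k) :
    (shrink t x).1 = t • x.1 := by
  change (projIcc 0 1 zero_le_one t : ℝ) • x.1 = _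
  rw [projIcc_of_mem zero_le_one ⟨h0, h1⟩]

lemma measurable_shrink {k : ℕ} (t : ℝ) : Measurable (shrink t : HalfBall k → HalfBall k) := by
  unfold shrink
  fun_prop

/-- The memory of the learner: a number `level` of successful refinements, a point `current` that
is certified to be near the boundary, the next `candidate` for such a point, a point `far` near the
boundary that is not strictly on the side of the center, the label of the center, whether the
center lies on the boundary, and the point `final` that is queried in the end. -/
structure SearchState (k : ℕ) where
  level : ℕ
  current : HalfBall k
  candidate : HalfBall k
  far : HalfBall k
  centerLabel : Prop
  isCentral : Prop
  final : HalfBall k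

namespace SearchState

variable {k : ℕ}

/-- The components of a state. -/
def toTuple (s : SearchState k) :
    ℕ × HalfBall k × HalfBall k × HalfBall k × Prop × Prop × HalfBall k :=
  (s.level, s.current, s.candidate, s.far, s.centerLabel, s.isCentral, s.final)

instance : MeasurableSpace (SearchState k) := MeasurableSpace.comap toTuple inferInstance

lemma measurable_toTuple : Measurable (toTuple (k := k)) := comap_measurable _

lemma measurable_level : Measurable (level (k := k)) := measurable_fst.comp measurable_toTuple

lemma measurable_current : Measurable (current (k := k)) :=
  measurable_fst.comp (measurable_snd.comp measurable_toTuple)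

lemma measurable_candidate : Measurable (candidate (k := k)) :=
  measurable_fst.comp (measurable_snd.comp (measurable_snd.comp measurable_toTuple))

lemma measurable_far : Measurable (far (k := k)) :=
  measurable_fst.comp (measurable_snd.comp (measurable_snd.comp (measurable_snd.comp
    measurable_toTuple)))

lemma measurable_centerLabel : Measurable (centerLabel (k := k)) :=
  measurable_fst.comp (measurable_snd.comp (measurable_snd.comp (measurable_snd.comp
    (measurable_snd.comp measurable_toTuple))))

lemma measurable_isCentral : Measurable (isCentral (k := k)) :=
  measurable_fst.comp (measurable_snd.comp (measurable_snd.comp (measurable_snd.comp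
    (measurable_snd.comp (measurable_snd.comp measurable_toTuple)))))

lemma measurable_final : Measurable (final (k := k)) :=
  measurable_snd.comp (measurable_snd.comp (measurable_snd.comp (measurable_snd.comp
    (measurable_snd.comp (measurable_snd.comp measurable_toTuple)))))

attribute [fun_prop] measurable_level measurable_current measurable_candidate measurable_far
  measurable_centerLabel measurable_isCentral measurable_final

lemma measurable_of_components {α : Type*} [MeasurableSpace α] {F : α → SearchState k}
    (h1 : Measurable fun a => (F a).level) (h2 : Measurable fun a => (F a).current)
    (h3 : Measurable fun a => (F a).candidate) (h4 : Measurable fun a => (F a).far)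
    (h5 : Measurable fun a => (F a).centerLabel) (h6 : Measurable fun a => (F a).isCentral)
    (h7 : Measurable fun a => (F a).final) : Measurable F :=
  measurable_comap_iff.2
    (h1.prodMk (h2.prodMk (h3.prodMk (h4.prodMk (h5.prodMk (h6.prodMk h7))))))

end SearchState

/-- The parameters of the learner: it performs `trials` attempts to reach the level `target`, where
level `i` means that the current point is at distance at most `radius i` from the boundary; in the
end it queries a point at distance at most `margin` from the boundary. -/
structure SearchParams where
  target : ℕ
  trials : ℕ
  radius : ℕ → ℝ≥0
  tol : ℝ

/-- A pair of labeled examples. -/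
abbrev Example (k : ℕ) := (HalfBall k × Prop) × (HalfBall k × Prop)

namespace SearchParams

open SearchState

variable {k : ℕ} (P : SearchParams)

open Classical in
/-- The first of two points near the boundary, of which at least one is not on the boundary. -/
noncomputable def firstProbe (ξ : HalfBall k) (s : SearchState k) : HalfBall k :=
  if s.isCentral then shrink (2 * P.tol) ξ else shrink (1 - 2 * P.tol) s.far

open Classical in
/-- The second of two points near the boundary, of which at least one is not on the boundary. -/
noncomputable def secondProbe (ξ : HalfBall k) (s : SearchState k) : HalfBall k :=
  if s.isCentral then shrink P.tol ξ else shrink (1 - P.tol) s.far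

open Classical in
/-- The contrastive example for the current point becomes the candidate. -/
noncomputable def recordCandidate (n : ℕ) (s : SearchState k) (e : Example k) : SearchState k :=
  { s with
    candidate := e.2.1
    centerLabel := if n = 0 then e.1.2 else s.centerLabel
    isCentral := if n = 0 then e.2.1 = center k else s.isCentral }

open Classical in
/-- The candidate becomes the current point if its contrastive example is near enough. -/
noncomputable def certify (s : SearchState k) (e : Example k) : SearchState k :=
  if s.level < P.target ∧ dist e.1.1 e.2.1 ≤ P.radius (s.level + 1) then
    { s with
      level := s.level + 1
      current := e.1.1
      far := if (e.1.2 ↔ s.centerLabel) then e.2.1 else e.1.1 }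
  else s

open Classical in
/-- The second probe is used if the first turned out to be its own contrastive example. -/
noncomputable def settle (ξ : HalfBall k) (s : SearchState k) (e : Example k) : SearchState k :=
  { s with final := if e.2.1 = e.1.1 then P.secondProbe ξ s else e.1.1 }

/-- The state after step `n`, in which the examples `e` were seen. -/
noncomputable def update (n : ℕ) (ξ : HalfBall k) (s : SearchState k) (e : Example k) :
    SearchState k :=
  if n < 2 * P.trials then if Even n then recordCandidate n s e else P.certify s e
  else if n = 2 * P.trials then P.settle ξ s e else s

/-- The query in step `n`. -/
noncomputable def nextQuery (n : ℕ) (ξ : HalfBall k) (s : SearchState k) : HalfBall k :=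
  if n < 2 * P.trials then if Even n then s.current else s.candidate
  else if n = 2 * P.trials then P.firstProbe ξ s else s.final

/-- The state before step `n`. -/
noncomputable def state : ∀ n, HalfBall k × History (HalfBall k) n → SearchState k
  | 0, _ => ⟨0, center k, center k, center k, False, False, center k⟩
  | n + 1, p => P.update n p.1 (state n (p.1, Fin.init p.2)) (p.2 (Fin.last n))

lemma measurable_firstProbe :
    Measurable fun q : HalfBall k × SearchState k => P.firstProbe q.1 q.2 := by
  unfold firstProbe
  refine Measurable.ite ?_ ((measurable_shrink _).comp (by fun_prop))
    ((measurable_shrink _).comp (by fun_prop))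
  exact measurableSet_setOfPred.2 (by fun_prop)

lemma measurable_secondProbe :
    Measurable fun q : HalfBall k × SearchState k => P.secondProbe q.1 q.2 := by
  unfold secondProbe
  refine Measurable.ite ?_ ((measurable_shrink _).comp (by fun_prop))
    ((measurable_shrink _).comp (by fun_prop))
  exact measurableSet_setOfPred.2 (by fun_prop)

lemma measurable_recordCandidate (n : ℕ) :
    Measurable fun q : SearchState k × Example k => recordCandidate n q.1 q.2 := by
  unfold recordCandidate
  refine measurable_of_components ?_ ?_ ?_ ?_ ?_ ?_ ?_ <;> dsimp only
  all_goals fun_prop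

lemma measurable_certify :
    Measurable fun q : SearchState k × Example k => P.certify q.1 q.2 := by
  unfold certify
  refine Measurable.ite ?_ ?_ (by fun_prop)
  · have h : Measurable fun i : ℕ => (P.radius (i + 1) : ℝ) := measurable_from_top
    have h1 : Measurable fun q : SearchState k × Example k => q.1.level := by fun_prop
    have h2 : Measurable fun q : SearchState k × Example k => dist q.2.1.1 q.2.2.1 := by fun_prop
    exact (measurableSet_lt h1 measurable_const).inter (measurableSet_le h2 (h.comp h1))
  · refine measurable_of_components ?_ ?_ ?_ ?_ ?_ ?_ ?_ <;> dsimp only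
    any_goals fun_prop
    refine Measurable.ite ?_ (by fun_prop) (by fun_prop)
    exact measurableSet_setOfPred.2 (Measurable.iff (by fun_prop) (by fun_prop))

lemma measurable_settle :
    Measurable fun q : HalfBall k × SearchState k × Example k => P.settle q.1 q.2.1 q.2.2 := by
  unfold settle
  refine measurable_of_components ?_ ?_ ?_ ?_ ?_ ?_ ?_ <;> dsimp only
  any_goals fun_prop
  have h1 : Measurable fun q : HalfBall k × SearchState k × Example k => q.2.2.2.1 := by fun_prop
  have h2 : Measurable fun q : HalfBall k × SearchState k × Example k => q.2.2.1.1 := by fun_prop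
  have h3 : Measurable fun q : HalfBall k × SearchState k × Example k => (q.1, q.2.1) := by fun_prop
  exact Measurable.ite (measurableSet_eq_fun h1 h2) (P.measurable_secondProbe.comp h3) h2

lemma measurable_update (n : ℕ) :
    Measurable fun q : HalfBall k × SearchState k × Example k =>
      P.update n q.1 q.2.1 q.2.2 := by
  unfold update
  split_ifs
  · exact (measurable_recordCandidate n).comp measurable_snd
  · exact P.measurable_certify.comp measurable_snd
  · exact P.measurable_settle
  · fun_prop

lemma measurable_nextQuery (n : ℕ) :
    Measurable fun q : HalfBall k × SearchState k => P.nextQuery n q.1 q.2 := by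
  unfold nextQuery
  split_ifs
  · fun_prop
  · fun_prop
  · exact P.measurable_firstProbe
  · fun_prop

lemma measurable_state (n : ℕ) : Measurable (P.state (k := k) n) := by
  induction n with
  | zero => exact measurable_const
  | succ n ih =>
    have h1 : Measurable fun p : HalfBall k × History (HalfBall k) (n + 1) =>
        P.state n (p.1, Fin.init p.2) := by
      refine ih.comp (measurable_fst.prodMk (measurable_pi_iff.2 fun i => ?_))
      exact (measurable_pi_apply i.castSucc).comp measurable_snd
    have h2 : Measurable fun p : HalfBall k × History (HalfBall k) (n + 1) => p.2 (Fin.last n) :=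
      (measurable_pi_apply _).comp measurable_snd
    exact (P.measurable_update n).comp (measurable_fst.prodMk (h1.prodMk h2))

lemma state_extend (ℓ : Set (HalfBall k)) {n : ℕ} (ξ : HalfBall k) (h : History (HalfBall k) n)
    (x x' : HalfBall k) :
    P.state (n + 1) (ξ, extend ℓ h x x') =
      P.update n ξ (P.state n (ξ, h)) ((x, x ∈ ℓ), (x', x' ∈ ℓ)) := by
  simp only [state, extend, Fin.init_snoc, Fin.snoc_last]

/-- An example at `y` agrees with the half-space `⟨w, ·⟩ ≥ b` if it has the right label and its
contrastive example is near the orthogonal projection of `y` to the hyperplane. -/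
def Agrees (f : ℝ≥0 → ℝ≥0) (w : EuclideanSpace ℝ (Fin k)) (b : ℝ) (y : HalfBall k)
    (e : Example k) : Prop :=
  (e.1.2 ↔ y ∈ halfSpace w b) ∧ dist e.2.1.1 (foot w b y) ≤ 12 / 5 * f ‖margin w b y‖₊

/-- The point `y` is off the hyperplane and near it, and its orthogonal projection is in the
ball. -/
structure IsNice (w : EuclideanSpace ℝ (Fin k)) (b : ℝ) (y : HalfBall k) : Prop where
  ne : margin w b y ≠ 0
  le : |margin w b y| ≤ P.tol
  norm_foot : ‖foot w b y‖ ≤ 1 / 2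

open Classical in
/-- The half-space `⟨w, ·⟩ ≥ b` explains the majority of the examples at the final point `y`. -/
structure Explains (f : ℝ≥0 → ℝ≥0) {n : ℕ} (h : History (HalfBall k) n) (y : HalfBall k)
    (w : EuclideanSpace ℝ (Fin k)) (b : ℝ) : Prop where
  norm_eq : ‖w‖ = 1
  nice : P.IsNice w b y
  majority : (Finset.univ.filter fun j : Fin n => 2 * P.trials < j ∧ ¬ Agrees f w b y (h j)).card <
    (Finset.univ.filter fun j : Fin n => 2 * P.trials < j ∧ Agrees f w b y (h j)).card

open Classical in
/-- A half-space that explains the majority of the final examples, if there is one. -/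
noncomputable def guess (f : ℝ≥0 → ℝ≥0) (n : ℕ) (p : HalfBall k × History (HalfBall k) n) :
    Set (HalfBall k) :=
  if h : ∃ q : EuclideanSpace ℝ (Fin k) × ℝ, P.Explains f p.2 (P.state n p).final q.1 q.2 then
    halfSpace h.choose.1 h.choose.2
  else halfSpace 0 0

/-- The learner that approaches the boundary, and then queries a point near the boundary until the
contrastive examples determine the half-space. -/
noncomputable def learner (k : ℕ) (f : ℝ≥0 → ℝ≥0) :
    ActiveLearner (HalfBall k) (halfSpaces k) where
  Seed := HalfBall k
  seedLaw := uniform k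
  query n p := P.nextQuery n p.1 (P.state n p)
  measurable_query n :=
    (P.measurable_nextQuery n).comp (measurable_fst.prodMk (P.measurable_state n))
  hypothesis n p := P.guess f n p
  hypothesis_mem n p := by
    unfold guess
    split_ifs
    · exact ⟨_, _, rfl⟩
    · exact ⟨_, _, rfl⟩

end SearchParams

/-! ### Half-spaces that explain a majority are close -/

lemma exists_mem_of_majorities {ι : Type*} (s : Finset ι) (p q : ι → Prop) [DecidablePred p]
    [DecidablePred q] (hp : (s.filter fun i => ¬ p i).card < (s.filter p).card)
    (hq : (s.filter fun i => ¬ q i).card < (s.filter q).card) : ∃ i ∈ s, p i ∧ q i := by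
  by_contra! h
  have h1 : s.filter p ⊆ s.filter fun i => ¬ q i := fun i hi => by
    rw [Finset.mem_filter] at hi ⊢
    exact ⟨hi.1, h i hi.1 hi.2⟩
  have h2 : s.filter q ⊆ s.filter fun i => ¬ p i := fun i hi => by
    rw [Finset.mem_filter] at hi ⊢
    exact ⟨hi.1, fun h' => h i hi.1 h' hi.2⟩
  have := Finset.card_le_card h1
  have := Finset.card_le_card h2
  omega

/-- The superlinear noise bound makes the error relative: near the hyperplane it is a small fraction
of the margin. Only this lets one example fix the direction of the normal. -/
lemma noise_le {f : ℝ≥0 → ℝ≥0} {c : ℝ} (hc : 0 < c) (hfc : ∀ x, f x ≤ x ^ (1 + c) / 4)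
    {m μ : ℝ} (hm : |m| ≤ μ) : (f ‖m‖₊ : ℝ) ≤ |m| * μ ^ c / 4 := by
  have h1 : (f ‖m‖₊ : ℝ) ≤ |m| ^ (1 + c) / 4 := by
    have := NNReal.coe_le_coe.2 (hfc ‖m‖₊)
    simpa using this
  refine h1.trans ?_
  rcases eq_or_lt_of_le (abs_nonneg m) with h0 | h0
  · rw [← h0, Real.zero_rpow (by linarith)]
    simp
  · rw [Real.rpow_add h0, Real.rpow_one]
    gcongr

namespace SearchParams

variable {k : ℕ} (P : SearchParams)

lemma explains_majority {f : ℝ≥0 → ℝ≥0} {n : ℕ} {h : History (HalfBall k) n} {y : HalfBall k}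
    {w : EuclideanSpace ℝ (Fin k)} {b : ℝ} (H : P.Explains f h y w b) :
    open Classical in
    (((Finset.univ.filter fun j : Fin n => 2 * P.trials < j).filter
      fun j => ¬ Agrees f w b y (h j)).card <
    ((Finset.univ.filter fun j : Fin n => 2 * P.trials < j).filter
      fun j => Agrees f w b y (h j)).card) := by
  rw [Finset.filter_filter, Finset.filter_filter]
  exact H.majority

lemma err_le_of_explains {n m : ℕ} {f : ℝ≥0 → ℝ≥0} {c ε : ℝ} (hc : 0 < c)
    (hfc : ∀ x, f x ≤ x ^ (1 + c) / 4) (hε : 0 < ε) (hε1 : ε ≤ 1) (htol : P.tol ≤ 27 / 128)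
    (htolc : P.tol ^ c ≤ ε / 2 ^ m) {h : History (HalfBall (m + 1)) n} {y : HalfBall (m + 1)}
    {w w' : EuclideanSpace ℝ (Fin (m + 1))} {b b' : ℝ}
    (H : P.Explains f h y w b) (H' : P.Explains f h y w' b') :
    err (uniform (m + 1)) (halfSpace w' b') (halfSpace w b) ≤ ε := by
  classical
  obtain ⟨j, -, ⟨hl, hd⟩, hl', hd'⟩ := exists_mem_of_majorities _ _ _
    (P.explains_majority H) (P.explains_majority H')
  have hside : 0 ≤ margin w b y ↔ 0 ≤ margin w' b' y := by
    rw [← mem_halfSpace, ← mem_halfSpace, ← hl, ← hl']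
  -- The shared example shows the same label at `y`, and neither hyperplane contains `y`.
  have hpos : 0 < margin w b y * margin w' b' y := by
    rcases H.nice.ne.lt_or_gt with h0 | h0
    · refine mul_pos_of_neg_of_neg h0 (not_le.1 fun h1 => ?_)
      exact absurd (hside.2 h1) (not_le.2 h0)
    · exact mul_pos h0 (lt_of_le_of_ne (hside.1 h0.le) H'.nice.ne.symm)
  refine err_halfSpace_le H.norm_eq H'.norm_eq hε hε1 htol hpos H.nice.le H'.nice.le ?_
  -- Agreement up to `12 / 5 * f`, with `f ≤ |m| * tol ^ c / 4`, gives the constant 3/5 for each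
  -- half-space.
  have h1 := noise_le hc hfc H.nice.le
  have h2 := noise_le hc hfc H'.nice.le
  have h3 : |margin w b y| * P.tol ^ c ≤ |margin w b y| * (ε / 2 ^ m) := by gcongr
  have h4 : |margin w' b' y| * P.tol ^ c ≤ |margin w' b' y| * (ε / 2 ^ m) := by gcongr
  have h5 := dist_triangle_left (foot w b y) (foot w' b' y) (h j).2.1.1
  linarith

lemma err_guess_le {n m : ℕ} {f : ℝ≥0 → ℝ≥0} {c ε : ℝ} (hc : 0 < c)
    (hfc : ∀ x, f x ≤ x ^ (1 + c) / 4) (hε : 0 < ε) (hε1 : ε ≤ 1) (htol : P.tol ≤ 27 / 128)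
    (htolc : P.tol ^ c ≤ ε / 2 ^ m) {p : HalfBall (m + 1) × History (HalfBall (m + 1)) n}
    {w : EuclideanSpace ℝ (Fin (m + 1))} {b : ℝ}
    (H : P.Explains f p.2 (P.state n p).final w b) :
    err (uniform (m + 1)) (P.guess f n p) (halfSpace w b) ≤ ε := by
  have h : ∃ q : EuclideanSpace ℝ (Fin (m + 1)) × ℝ,
      P.Explains f p.2 (P.state n p).final q.1 q.2 := ⟨(w, b), H⟩
  rw [guess, dif_pos h]
  exact P.err_le_of_explains hc hfc hε hε1 htol htolc H h.choose_spec

end SearchParams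

/-! ### Points whose projection to the hyperplane stays in the ball -/

section Probes

variable {k : ℕ} {w : EuclideanSpace ℝ (Fin k)} {b : ℝ}

lemma norm_foot_sq (hw : ‖w‖ = 1) (x : HalfBall k) :
    ‖foot w b x‖ ^ 2 = ‖x.1‖ ^ 2 - (inner ℝ w x.1) ^ 2 + b ^ 2 := by
  rw [foot, norm_sub_sq_real, norm_smul, hw, real_inner_smul_right, real_inner_comm, mul_one,
    Real.norm_eq_abs, sq_abs, margin]
  ring

lemma margin_center : margin w b (center k) = -b := by simp [margin, center]

lemma abs_offset_le (hw : ‖w‖ = 1) (hne : (boundary w b).Nonempty) : |b| ≤ 1 / 2 := by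
  obtain ⟨z, hz⟩ := hne
  have h := abs_real_inner_le_norm w z.1
  have : inner ℝ w z.1 = b := by
    have : margin w b z = 0 := hz
    rw [margin] at this
    linarith
  rw [this, hw, one_mul] at h
  exact h.trans z.norm_le

/-- A dilation of a seed point is near a hyperplane through the center. -/
lemma shrink_seed_near (hw : ‖w‖ = 1) {t μ : ℝ} (ht0 : 0 ≤ t) (ht : t ≤ 2 * μ) (ht1 : t ≤ 1)
    (ξ : HalfBall k) :
    margin w 0 (shrink t ξ) = t * inner ℝ w ξ.1 ∧ |margin w 0 (shrink t ξ)| ≤ μ ∧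
      ‖foot w 0 (shrink t ξ)‖ ≤ 1 / 2 := by
  have h : margin w 0 (shrink t ξ) = t * inner ℝ w ξ.1 := by
    rw [margin, coe_shrink ht0 ht1, real_inner_smul_right, sub_zero]
  refine ⟨h, ?_, ?_⟩
  · rw [h, abs_mul, abs_of_nonneg ht0]
    have h1 := abs_real_inner_le_norm w ξ.1
    rw [hw, one_mul] at h1
    nlinarith [ξ.norm_le, abs_nonneg (inner ℝ w ξ.1)]
  · refine le_of_sq_le_sq ?_ (by norm_num)
    rw [norm_foot_sq hw]
    have h1 := (shrink t ξ).norm_le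
    nlinarith [norm_nonneg (shrink t ξ).1, sq_nonneg (inner ℝ w (shrink t ξ).1)]

/-- Moving a point `z` near the hyperplane, and not strictly on the side of the center, towards the
center keeps it near the hyperplane, and its orthogonal projection is in the ball. -/
lemma shrink_far_near (hw : ‖w‖ = 1) (hne : (boundary w b).Nonempty) {t μ : ℝ} (ht0 : 0 ≤ t)
    (ht : t ≤ 2 * μ) (ht1 : t ≤ 1) {z : HalfBall k}
    (hz : margin w b (center k) * margin w b z ≤ 0) (hzμ : |margin w b z| ≤ μ) :
    margin w b (shrink (1 - t) z) = (1 - t) * inner ℝ w z.1 - b ∧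
      |margin w b (shrink (1 - t) z)| ≤ μ ∧ ‖foot w b (shrink (1 - t) z)‖ ≤ 1 / 2 := by
  have hc := coe_shrink (sub_nonneg.2 ht1) (sub_le_self _ ht0) z
  have h : margin w b (shrink (1 - t) z) = (1 - t) * inner ℝ w z.1 - b := by
    rw [margin, hc, real_inner_smul_right]
  have hb := abs_le.1 (abs_offset_le hw hne)
  rw [margin_center] at hz
  simp only [margin] at hz hzμ
  set α := inner ℝ w z.1
  rw [abs_le] at hzμ
  have hbα : b ^ 2 ≤ α ^ 2 := by nlinarith [sq_nonneg (α - b)]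
  refine ⟨h, ?_, ?_⟩
  -- The margin of `z` lies between 0 and `±μ`, on the side away from the center. The dilation
  -- shifts it towards the center's side by at most `t / 2 ≤ μ`.
  · rw [h, abs_le]
    rcases lt_trichotomy b 0 with hb0 | hb0 | hb0
    · have : α - b ≤ 0 := by nlinarith
      constructor <;> nlinarith
    · subst hb0
      constructor <;> nlinarith
    · have : 0 ≤ α - b := by nlinarith
      constructor <;> nlinarith
  -- The squared norm of the foot is `(1 - t) ^ 2 * (‖z‖ ^ 2 - α ^ 2) + b ^ 2`, and `b ^ 2 ≤ α ^ 2`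
  -- because `z` is not strictly on the center's side.
  · refine le_of_sq_le_sq ?_ (by norm_num)
    rw [norm_foot_sq hw, hc, norm_smul, real_inner_smul_right, mul_pow, Real.norm_eq_abs, sq_abs]
    have h1 := z.norm_le
    have h2 : α ^ 2 ≤ ‖z.1‖ ^ 2 := by
      have := abs_real_inner_le_norm w z.1
      rw [hw, one_mul] at this
      rw [← sq_abs]
      gcongr
    have h3 : (1 - t) ^ 2 ≤ 1 := by nlinarith
    have h4 : ‖z.1‖ ^ 2 ≤ (1 / 2) ^ 2 := by gcongr
    nlinarith

end Probes

lemma abs_le_of_opposite {x y d : ℝ} (h : x * y ≤ 0) (hd : |x - y| ≤ d) : |x| ≤ d ∧ |y| ≤ d := by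
  have h1 : x ^ 2 ≤ (x - y) ^ 2 := by nlinarith [sq_nonneg y]
  have h2 : y ^ 2 ≤ (x - y) ^ 2 := by nlinarith [sq_nonneg x]
  exact ⟨(sq_le_sq.1 h1).trans hd, (sq_le_sq.1 h2).trans hd⟩

/-! ### Soundness and drift of the search -/

namespace SearchParams

variable {k : ℕ} (P : SearchParams) {f : ℝ≥0 → ℝ≥0} {w : EuclideanSpace ℝ (Fin k)} {b : ℝ}
  {D : Kernel (HalfBall k) (HalfBall k)}

/-- The radii shrink as fast as the noise allows. -/
structure IsAdapted (f : ℝ≥0 → ℝ≥0) : Prop where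
  mono : Monotone f
  le_quarter : ∀ x ≤ 1, f x ≤ x / 4
  radius_zero : P.radius 0 = 1 / 2
  radius_succ : ∀ i, P.radius (i + 1) = 3 * f (P.radius i)
  target_pos : 0 < P.target
  radius_target : P.radius P.target ≤ P.tol
  tol_pos : 0 < P.tol
  tol_le : 2 * P.tol ≤ 1
  trials_pos : 0 < P.trials

lemma IsAdapted.map_zero {P : SearchParams} (hP : P.IsAdapted f) : f 0 = 0 := by
  simpa using hP.le_quarter 0 zero_le_one

/-- The memory of the learner before step `n` of the search is correct. -/
structure IsSound (w : EuclideanSpace ℝ (Fin k)) (b : ℝ) (n : ℕ) (ξ : HalfBall k)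
    (s : SearchState k) : Prop where
  seed : b = 0 → inner ℝ w ξ.1 ≠ 0
  level_le : s.level ≤ P.target
  gap_le : gap w b s.current ≤ P.radius s.level
  far : 0 < s.level → margin w b (center k) * margin w b s.far ≤ 0 ∧
    |margin w b s.far| ≤ P.radius s.level
  start : n = 0 → s.current = center k
  center : 0 < n → (s.centerLabel ↔ center k ∈ halfSpace w b) ∧ (s.isCentral ↔ b = 0)

/-- The pair of labeled examples for the query `x` and the contrastive example `x'`. -/
def exampleOf (w : EuclideanSpace ℝ (Fin k)) (b : ℝ) (x x' : HalfBall k) : Example k :=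
  ((x, x ∈ halfSpace w b), (x', x' ∈ halfSpace w b))

open Classical in
lemma certify_of_le {s : SearchState k} {x x' : HalfBall k}
    (h : s.level < P.target ∧ dist x x' ≤ P.radius (s.level + 1)) :
    P.certify s (exampleOf w b x x') =
      { s with
        level := s.level + 1
        current := x
        far := if (x ∈ halfSpace w b ↔ s.centerLabel) then x' else x } := if_pos h

lemma certify_of_not_le {s : SearchState k} {x x' : HalfBall k}
    (h : ¬ (s.level < P.target ∧ dist x x' ≤ P.radius (s.level + 1))) :
    P.certify s (exampleOf w b x x') = s := if_neg h

/-- The query in step 0 is the center, which almost surely is its own contrastive example exactly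
when it lies on the hyperplane. This decides whether `b = 0`. -/
lemma isSound_recordCandidate (hD : IsBoundaryOracle f w b D) (hf : f 0 = 0) {n : ℕ}
    {ξ : HalfBall k} {s : SearchState k} (hs : P.IsSound w b n ξ s) :
    ∀ᵐ x' ∂(D s.current), P.IsSound w b (n + 1) ξ
      (recordCandidate n s (exampleOf w b s.current x')) := by
  have hcen : ∀ᵐ x' ∂(D (center k)), x' = center k ↔ b = 0 := by
    by_cases hb : b = 0
    · filter_upwards [hD.contrastive_eq hf (x := center k) (by rw [margin_center, hb, neg_zero])]
        with x' hx'
      exact iff_of_true hx' hb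
    · filter_upwards [hD.opposite (center k)] with x' hx'
      refine iff_of_false (fun h => ?_) hb
      rw [h, margin_center] at hx'
      have := sq_pos_of_pos (abs_pos.2 hb)
      rw [sq_abs] at this
      linarith
  by_cases hn : n = 0
  · rw [hs.start hn]
    filter_upwards [hcen] with x' hx'
    refine ⟨hs.seed, hs.level_le, hs.gap_le, hs.far, fun h => absurd h (Nat.succ_ne_zero n),
      fun _ => ?_⟩
    simp only [recordCandidate, hn, if_true, exampleOf]
    exact ⟨trivial, hx'⟩
  · refine Filter.Eventually.of_forall fun x' =>
      ⟨hs.seed, hs.level_le, hs.gap_le, hs.far, fun h => absurd h (Nat.succ_ne_zero n), fun _ => ?_⟩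
    simp only [recordCandidate, hn, if_false]
    exact hs.center (Nat.pos_of_ne_zero hn)

/-- An accepted candidate and its contrastive example are on opposite sides (or on the boundary) at
distance at most the new radius, so both are that close to the hyperplane, and one of them is not
strictly on the center's side. -/
lemma isSound_certify (hw : ‖w‖ = 1) (hD : IsBoundaryOracle f w b D) {n : ℕ} (hn : 0 < n)
    {ξ : HalfBall k} {s : SearchState k} (hs : P.IsSound w b n ξ s) :
    ∀ᵐ x' ∂(D s.candidate), P.IsSound w b (n + 1) ξ
      (P.certify s (exampleOf w b s.candidate x')) := by
  filter_upwards [hD.opposite s.candidate, hD.side s.candidate] with x' hx' hside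
  by_cases hc : s.level < P.target ∧ dist s.candidate x' ≤ P.radius (s.level + 1)
  · rw [P.certify_of_le hc]
    obtain ⟨hlt, hdist⟩ := hc
    refine ⟨hs.seed, hlt, (gap_le_of_opposite hx').trans hdist, fun _ => ?_,
      fun h => absurd h (Nat.succ_ne_zero n), fun _ => hs.center hn⟩
    obtain ⟨habs, habs'⟩ := abs_le_of_opposite hx' (abs_margin_sub_le hw s.candidate x')
    have hlab := (hs.center hn).1
    split_ifs with hl
    · constructor
      · by_cases hcs : center k ∈ halfSpace w b
        · exact mul_nonpos_of_nonneg_of_nonpos (mem_halfSpace.1 hcs)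
            (hside.1 (hl.2 (hlab.2 hcs)))
        · have h1 := hside.2 fun h => hcs (hlab.1 (hl.1 h))
          rw [mem_halfSpace, not_le] at hcs
          exact mul_nonpos_of_nonpos_of_nonneg hcs.le h1
      · exact habs'.trans hdist
    · constructor
      · rw [hlab] at hl
        rw [mem_halfSpace, mem_halfSpace] at hl
        rcases le_or_gt 0 (margin w b s.candidate) with h | h <;>
        rcases le_or_gt 0 (margin w b (Contrastive.center k)) with h' | h'
        · exact absurd (iff_of_true h h') hl
        · exact mul_nonpos_of_nonpos_of_nonneg h'.le h
        · exact mul_nonpos_of_nonneg_of_nonpos h' h.le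
        · exact absurd (iff_of_false (not_le.2 h) (not_le.2 h')) hl
      · exact habs.trans hdist
  · rw [P.certify_of_not_le hc]
    exact ⟨hs.seed, hs.level_le, hs.gap_le, hs.far, fun h => absurd h (Nat.succ_ne_zero n),
      fun _ => hs.center hn⟩

open Classical in
/-- A potential for the search: it decreases by a constant factor in two steps. -/
noncomputable def searchPotential (f : ℝ≥0 → ℝ≥0) (w : EuclideanSpace ℝ (Fin k)) (b : ℝ) (n : ℕ)
    (ξ : HalfBall k) (s : SearchState k) : ℝ≥0∞ :=
  if P.IsSound w b n ξ s then
    if P.target ≤ s.level then 0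
    else if ¬ Even n ∧ gap w b s.candidate ≤ 2 * f (P.radius s.level) then
      5 * 4 ^ (P.target - s.level)
    else 8 * 4 ^ (P.target - s.level)
  else ∞

lemma searchPotential_le {n : ℕ} {ξ : HalfBall k} {s : SearchState k}
    (hs : P.IsSound w b n ξ s) :
    P.searchPotential f w b n ξ s ≤ 8 * 4 ^ (P.target - s.level) := by
  unfold searchPotential
  rw [if_pos hs]
  split_ifs
  · exact zero_le
  · gcongr
    norm_num
  · exact le_rfl

lemma searchPotential_of_not_isSound {n : ℕ} {ξ : HalfBall k} {s : SearchState k}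
    (hs : ¬ P.IsSound w b n ξ s) : P.searchPotential f w b n ξ s = ∞ := if_neg hs

lemma searchPotential_of_target_le {n : ℕ} {ξ : HalfBall k} {s : SearchState k}
    (hs : P.IsSound w b n ξ s) (h : P.target ≤ s.level) :
    P.searchPotential f w b n ξ s = 0 := by
  rw [searchPotential, if_pos hs, if_pos h]

/-- With probability at least 1/2 the candidate is good, and the factor 8 drops to 5; the mean is
`(5 + 8) / 2 = 13 / 16 * 8`. The value `∞` at unsound states makes the claim trivial there, while a
finite expectation forces soundness almost surely. -/
lemma lintegral_searchPotential_recordCandidate (hP : P.IsAdapted f)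
    (hD : IsBoundaryOracle f w b D) {n : ℕ} (hn : Even n) (ξ : HalfBall k) (s : SearchState k) :
    ∫⁻ x', P.searchPotential f w b (n + 1) ξ
      (recordCandidate n s (exampleOf w b s.current x')) ∂(D s.current) ≤
      13 / 16 * P.searchPotential f w b n ξ s := by
  have := hD.markov
  by_cases hs : P.IsSound w b n ξ s
  swap
  · rw [P.searchPotential_of_not_isSound hs, ENNReal.mul_top (by norm_num)]
    exact le_top
  have hae := P.isSound_recordCandidate hD hP.map_zero hs
  by_cases ht : P.target ≤ s.level
  · refine le_trans (le_of_eq ?_) zero_le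
    rw [← lintegral_zero (μ := D s.current)]
    refine lintegral_congr_ae ?_
    filter_upwards [hae] with x' hx'
    exact P.searchPotential_of_target_le hx' ht
  have hgood : D s.current {x' | ¬ gap w b x' ≤ 2 * f (P.radius s.level)} ≤ 2⁻¹ := by
    have h1 : (f (gap w b s.current).toNNReal : ℝ) ≤ f (P.radius s.level) :=
      hP.mono (Real.toNNReal_le_iff_le_coe.2 hs.gap_le)
    have hsub : {x' | ¬ gap w b x' ≤ 2 * f (P.radius s.level)} ⊆
        {x' | ¬ gap w b x' ≤ 2 * f (gap w b s.current).toNNReal} :=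
      fun x' hx' hle => hx' (hle.trans (by gcongr))
    exact (measure_mono hsub).trans (hD.gap_contrastive s.current)
  refine (lintegral_le_of_ae_le_of_measure_le (a := 5 * 4 ^ (P.target - s.level))
    (c := 3 * 4 ^ (P.target - s.level)) hgood ?_ ?_).trans (le_of_eq ?_)
  · filter_upwards [hae] with x' hx' hg
    rw [searchPotential, if_pos hx']
    have hev : ¬ Even (n + 1) := by rwa [Nat.even_add_one, not_not]
    rw [if_neg (show ¬ P.target ≤ (recordCandidate n s (exampleOf w b s.current x')).level from ht),
      if_pos ⟨hev, hg⟩]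
    exact le_rfl
  · filter_upwards [hae] with x' hx'
    refine (P.searchPotential_le hx').trans (le_of_eq ?_)
    rw [← add_mul]
    congr 1
    norm_num
  · have h1 : P.searchPotential f w b n ξ s = 8 * 4 ^ (P.target - s.level) := by
      rw [searchPotential, if_pos hs, if_neg ht, if_neg (fun h => h.1 hn)]
    have h2 : (5 + 3 * 2⁻¹ : ℝ≥0∞) = 13 / 16 * 8 := by
      rw [← ENNReal.toReal_eq_toReal_iff' (by finiteness) (by finiteness)]
      rw [ENNReal.toReal_add (by finiteness) (by finiteness)]
      simp
      norm_num
    rw [h1, ← mul_assoc, ← h2]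
    ring

/-- From a good candidate the level rises with probability at least 1/2, so the factor has mean at
most `(8 / 4 + 8) / 2 = 5`. A bad candidate does no harm, since levels never drop. -/
lemma lintegral_searchPotential_certify (hP : P.IsAdapted f) (hw : ‖w‖ = 1)
    (hD : IsBoundaryOracle f w b D) {n : ℕ} (hn : ¬ Even n) (ξ : HalfBall k) (s : SearchState k) :
    ∫⁻ x', P.searchPotential f w b (n + 1) ξ
      (P.certify s (exampleOf w b s.candidate x')) ∂(D s.candidate) ≤
      P.searchPotential f w b n ξ s := by
  have := hD.markov
  have hn0 : 0 < n := Nat.pos_of_ne_zero fun h => hn (by simp [h])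
  by_cases hs : P.IsSound w b n ξ s
  swap
  · rw [P.searchPotential_of_not_isSound hs]
    exact le_top
  have hae := P.isSound_certify hw hD hn0 hs
  have hlev : ∀ x', s.level ≤ (P.certify s (exampleOf w b s.candidate x')).level := fun x' => by
    by_cases hc : s.level < P.target ∧ dist s.candidate x' ≤ P.radius (s.level + 1)
    · rw [P.certify_of_le hc]
      exact Nat.le_succ _
    · rw [P.certify_of_not_le hc]
  by_cases ht : P.target ≤ s.level
  · refine le_trans (le_of_eq ?_) zero_le
    rw [← lintegral_zero (μ := D s.candidate)]
    refine lintegral_congr_ae ?_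
    filter_upwards [hae] with x' hx'
    exact P.searchPotential_of_target_le hx' (ht.trans (hlev x'))
  have hle8 : ∀ᵐ x' ∂(D s.candidate), P.searchPotential f w b (n + 1) ξ
      (P.certify s (exampleOf w b s.candidate x')) ≤ 8 * 4 ^ (P.target - s.level) := by
    filter_upwards [hae] with x' hx'
    refine (P.searchPotential_le hx').trans ?_
    gcongr
    · norm_num
    · exact hlev x'
  by_cases hg : gap w b s.candidate ≤ 2 * f (P.radius s.level)
  · have h1 : P.searchPotential f w b n ξ s = 5 * 4 ^ (P.target - s.level) := by
      rw [searchPotential, if_pos hs, if_neg ht, if_pos ⟨hn, hg⟩]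
    -- With `g ≤ 2 * f r` the gap of the candidate and `f g ≤ g / 4`, one has `g + 2 * f g ≤ 3 / 2 *
    -- g ≤ 3 * f r`, which is the next radius.
    have hgood : D s.candidate {x' | ¬ dist s.candidate x' ≤ P.radius (s.level + 1)} ≤ 2⁻¹ := by
      have h2 := hP.le_quarter (gap w b s.candidate).toNNReal
        (Real.toNNReal_le_one.2 (gap_le_one hD.nonempty _))
      have h3 : (f (gap w b s.candidate).toNNReal : ℝ) ≤ gap w b s.candidate / 4 := by
        have := NNReal.coe_le_coe.2 h2
        rwa [NNReal.coe_div, Real.coe_toNNReal _ (gap_nonneg _)] at this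
      have hsub : {x' | ¬ dist s.candidate x' ≤ P.radius (s.level + 1)} ⊆ {x' | ¬ dist s.candidate x' ≤
          gap w b s.candidate + 2 * f (gap w b s.candidate).toNNReal} := by
        intro x' hx' hle
        refine hx' (hle.trans ?_)
        rw [hP.radius_succ]
        push_cast
        linarith
      exact (measure_mono hsub).trans (hD.dist_contrastive s.candidate)
    rw [h1]
    refine (lintegral_le_of_ae_le_of_measure_le (a := 2 * 4 ^ (P.target - s.level))
      (c := 6 * 4 ^ (P.target - s.level)) hgood ?_ ?_).trans (le_of_eq ?_)
    · filter_upwards [hae] with x' hx' hd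
      refine (P.searchPotential_le hx').trans ?_
      have hl : (P.certify s (exampleOf w b s.candidate x')).level = s.level + 1 := by
        rw [P.certify_of_le ⟨not_le.1 ht, hd⟩]
      rw [hl, show P.target - s.level = (P.target - (s.level + 1)) + 1 by omega, pow_succ']
      rw [← mul_assoc]
      gcongr
      norm_num
    · filter_upwards [hle8] with x' hx'
      refine hx'.trans (le_of_eq ?_)
      rw [← add_mul]
      congr 1
      norm_num
    · have h2 : (6 * 2⁻¹ : ℝ≥0∞) = 3 := by
        rw [← ENNReal.toReal_eq_toReal_iff' (by finiteness) (by finiteness)]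
        simp
        norm_num
      rw [mul_right_comm, h2, ← add_mul]
      congr 1
      norm_num
  · have h1 : P.searchPotential f w b n ξ s = 8 * 4 ^ (P.target - s.level) := by
      rw [searchPotential, if_pos hs, if_neg ht, if_neg (fun h => hg h.2)]
    rw [h1]
    calc _ ≤ ∫⁻ _, 8 * 4 ^ (P.target - s.level) ∂(D s.candidate) := lintegral_mono_ae hle8
      _ = _ := by simp

/-- After a complete search, the settled point is suitable for the final queries. -/
lemma isNice_settle (hP : P.IsAdapted f) (hw : ‖w‖ = 1) (hD : IsBoundaryOracle f w b D)
    {ξ : HalfBall k} {s : SearchState k} (hs : P.IsSound w b (2 * P.trials) ξ s)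
    (ht : P.target ≤ s.level) :
    ∀ᵐ x' ∂(D (P.firstProbe ξ s)), P.IsNice w b
      (P.settle ξ s (exampleOf w b (P.firstProbe ξ s) x')).final := by
  have htol := hP.tol_pos
  have htol' := hP.tol_le
  obtain ⟨h1, h2, h3⟩ : (|margin w b (P.firstProbe ξ s)| ≤ P.tol ∧
        ‖foot w b (P.firstProbe ξ s)‖ ≤ 1 / 2) ∧
      (|margin w b (P.secondProbe ξ s)| ≤ P.tol ∧ ‖foot w b (P.secondProbe ξ s)‖ ≤ 1 / 2) ∧
      (margin w b (P.firstProbe ξ s) = 0 → margin w b (P.secondProbe ξ s) ≠ 0) := by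
    have hcen := (hs.center (Nat.mul_pos two_pos hP.trials_pos)).2
    unfold firstProbe secondProbe
    -- If `b = 0`, dilations preserve the hyperplane and `far` may lie on it; the random seed almost
    -- surely does not.
    by_cases hb : b = 0
    · rw [if_pos (hcen.2 hb), if_pos (hcen.2 hb)]
      have hξ := hs.seed hb
      subst hb
      obtain ⟨e1, h1⟩ := shrink_seed_near hw (by positivity) le_rfl htol' ξ
      obtain ⟨e2, h2⟩ := shrink_seed_near (μ := P.tol) hw htol.le (by linarith) (by linarith) ξ
      refine ⟨h1, h2, fun _ => ?_⟩
      rw [e2]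
      exact mul_ne_zero htol.ne' hξ
    · rw [if_neg (fun h => hb (hcen.1 h)), if_neg (fun h => hb (hcen.1 h))]
      have hlev : s.level = P.target := le_antisymm hs.level_le ht
      obtain ⟨hf1, hf2⟩ := hs.far (hP.target_pos.trans_le ht)
      rw [hlev] at hf2
      have hf3 := hf2.trans hP.radius_target
      obtain ⟨e1, h1⟩ := shrink_far_near hw hD.nonempty (by positivity) le_rfl htol' hf1 hf3
      obtain ⟨e2, h2⟩ := shrink_far_near (t := P.tol) hw hD.nonempty htol.le (by linarith)
        (by linarith) hf1 hf3
      -- If both dilations of `far` were on the hyperplane, their difference would give `⟨w, far⟩ =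
      -- 0`, and then `b = 0`.
      refine ⟨h1, h2, fun h h' => hb ?_⟩
      rw [e1] at h
      rw [e2] at h'
      have h4 : P.tol * inner ℝ w s.far.1 = 0 := by linarith
      rcases mul_eq_zero.1 h4 with h5 | h5
      · exact absurd h5 htol.ne'
      · rw [h5] at h'
        linarith
  -- As `f 0 = 0`, a point is almost surely its own contrastive example if it is on the boundary,
  -- and almost surely not otherwise. So the test in `settle` detects a useless first probe.
  by_cases h0 : margin w b (P.firstProbe ξ s) = 0
  · filter_upwards [hD.contrastive_eq hP.map_zero h0] with x' hx'
    have : (P.settle ξ s (exampleOf w b (P.firstProbe ξ s) x')).final = P.secondProbe ξ s := by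
      rw [settle]
      exact if_pos hx'
    rw [this]
    exact ⟨h3 h0, h2.1, h2.2⟩
  · filter_upwards [hD.opposite (P.firstProbe ξ s)] with x' hx'
    have hne : x' ≠ P.firstProbe ξ s := fun h => by
      rw [h] at hx'
      have := sq_pos_of_pos (abs_pos.2 h0)
      rw [sq_abs] at this
      linarith
    have : (P.settle ξ s (exampleOf w b (P.firstProbe ξ s) x')).final = P.firstProbe ξ s := by
      rw [settle]
      exact if_neg hne
    rw [this]
    exact ⟨h0, h1.1, h1.2⟩

end SearchParams

/-! ### Measurability of the invariants and potentials -/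

lemma measurableSet_halfSpace {k : ℕ} (w : EuclideanSpace ℝ (Fin k)) (b : ℝ) :
    MeasurableSet (halfSpace w b) :=
  measurableSet_le measurable_const (by fun_prop)

namespace SearchParams

variable {k : ℕ} (P : SearchParams) {f : ℝ≥0 → ℝ≥0} {w : EuclideanSpace ℝ (Fin k)} {b : ℝ}
  {D : Kernel (HalfBall k) (HalfBall k)}

lemma measurableSet_isSound (w : EuclideanSpace ℝ (Fin k)) (b : ℝ) (n : ℕ) :
    MeasurableSet {q : HalfBall k × SearchState k | P.IsSound w b n q.1 q.2} := by
  have hr : Measurable fun i : ℕ => (P.radius i : ℝ) := measurable_from_top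
  have hm : Measurable (margin w b) := continuous_margin.measurable
  have hg : Measurable (gap w b) := continuous_gap.measurable
  have h1 : Measurable fun q : HalfBall k × SearchState k => b = 0 → inner ℝ w q.1.1 ≠ 0 := by
    refine Measurable.imp measurable_const (Measurable.not ?_)
    refine measurableSet_setOfPred.1 (measurableSet_eq_fun ?_ measurable_const)
    fun_prop
  have h2 : Measurable fun q : HalfBall k × SearchState k => q.2.level ≤ P.target := by
    refine measurableSet_setOfPred.1 (measurableSet_le ?_ measurable_const)
    fun_prop
  have h3 : Measurable fun q : HalfBall k × SearchState k =>
      gap w b q.2.current ≤ P.radius q.2.level :=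
    measurableSet_setOfPred.1 (measurableSet_le (hg.comp (by fun_prop)) (hr.comp (by fun_prop)))
  have h4 : Measurable fun q : HalfBall k × SearchState k => 0 < q.2.level →
      margin w b (Contrastive.center k) * margin w b q.2.far ≤ 0 ∧
        |margin w b q.2.far| ≤ P.radius q.2.level := by
    have hf : Measurable fun q : HalfBall k × SearchState k => margin w b q.2.far :=
      hm.comp (by fun_prop)
    refine Measurable.imp (measurableSet_setOfPred.1 (measurableSet_lt measurable_const ?_))
      (Measurable.and (measurableSet_setOfPred.1 (measurableSet_le (hf.const_mul _)
        measurable_const)) (measurableSet_setOfPred.1 (measurableSet_le hf.abs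
        (hr.comp (by fun_prop)))))
    fun_prop
  have h5 : Measurable fun q : HalfBall k × SearchState k =>
      n = 0 → q.2.current = Contrastive.center k := by
    refine Measurable.imp measurable_const
      (measurableSet_setOfPred.1 (measurableSet_eq_fun ?_ measurable_const))
    fun_prop
  have h6 : Measurable fun q : HalfBall k × SearchState k => 0 < n →
      (q.2.centerLabel ↔ Contrastive.center k ∈ halfSpace w b) ∧ (q.2.isCentral ↔ b = 0) := by
    refine Measurable.imp measurable_const (Measurable.and
      (Measurable.iff ?_ measurable_const) (Measurable.iff ?_ measurable_const)) <;> fun_prop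
  refine measurableSet_setOfPred.2 ?_
  convert h1.and (h2.and (h3.and (h4.and (h5.and h6)))) using 2 with q
  exact ⟨fun h => ⟨h.1, h.2, h.3, h.4, h.5, h.6⟩,
    fun ⟨a1, a2, a3, a4, a5, a6⟩ => ⟨a1, a2, a3, a4, a5, a6⟩⟩

lemma measurable_searchPotential (f : ℝ≥0 → ℝ≥0) (w : EuclideanSpace ℝ (Fin k)) (b : ℝ) (n : ℕ) :
    Measurable fun q : HalfBall k × SearchState k => P.searchPotential f w b n q.1 q.2 := by
  have hl : Measurable fun q : HalfBall k × SearchState k => q.2.level := by fun_prop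
  have hr : Measurable fun i : ℕ => (2 * f (P.radius i) : ℝ) := measurable_from_top
  have h4 : ∀ a : ℝ≥0∞, Measurable fun i : ℕ => a * 4 ^ (P.target - i) :=
    fun a => measurable_from_top
  unfold searchPotential
  refine Measurable.ite (P.measurableSet_isSound w b n) ?_ measurable_const
  refine Measurable.ite (measurableSet_le measurable_const hl) measurable_const ?_
  refine Measurable.ite ?_ ((h4 5).comp hl) ((h4 8).comp hl)
  refine (MeasurableSet.const _).inter (measurableSet_le ?_ (hr.comp hl))
  exact continuous_gap.measurable.comp (by fun_prop)

lemma measurableSet_isNice (w : EuclideanSpace ℝ (Fin k)) (b : ℝ) :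
    MeasurableSet {y : HalfBall k | P.IsNice w b y} := by
  have hm : Measurable (margin w b) := continuous_margin.measurable
  have hf : Measurable fun y => ‖foot w b y‖ := by
    unfold foot
    exact ((measurable_subtype_coe.sub (hm.smul_const w))).norm
  have : {y : HalfBall k | P.IsNice w b y} =
      {y | margin w b y ≠ 0} ∩ ({y | |margin w b y| ≤ P.tol} ∩ {y | ‖foot w b y‖ ≤ 1 / 2}) := by
    ext y
    exact ⟨fun h => ⟨h.1, h.2, h.3⟩, fun h => ⟨h.1, h.2.1, h.2.2⟩⟩
  rw [this]
  exact (measurableSet_eq_fun hm measurable_const).compl.inter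
    ((measurableSet_le hm.abs measurable_const).inter (measurableSet_le hf measurable_const))

lemma measurableSet_agrees (hf : Measurable f) (w : EuclideanSpace ℝ (Fin k)) (b : ℝ) :
    MeasurableSet {q : HalfBall k × Example k | Agrees f w b q.1 q.2} := by
  have hm : Measurable (margin w b) := continuous_margin.measurable
  have hfo : Measurable (foot w b) := by
    unfold foot
    exact measurable_subtype_coe.sub (hm.smul_const w)
  have h1 : Measurable fun q : HalfBall k × Example k => (q.2.1.2 ↔ q.1 ∈ halfSpace w b) := by
    refine Measurable.iff ?_ ((measurable_mem.2 (measurableSet_halfSpace w b)).comp measurable_fst)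
    fun_prop
  have h2 : Measurable fun q : HalfBall k × Example k => dist q.2.2.1.1 (foot w b q.1) :=
    Measurable.dist (by fun_prop) (hfo.comp measurable_fst)
  have h3 : Measurable fun q : HalfBall k × Example k =>
      (12 / 5 * f ‖margin w b q.1‖₊ : ℝ) := by
    have : Measurable fun q : HalfBall k × Example k => f ‖margin w b q.1‖₊ :=
      hf.comp (hm.comp measurable_fst).nnnorm
    exact this.coe_nnreal_real.const_mul _
  exact (measurableSet_setOfPred.2 h1).inter (measurableSet_le h2 h3)

/-! ### Expected potentials of the learner -/

/-- The law of the first `n` steps of the learner. -/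
noncomputable abbrev law (f : ℝ≥0 → ℝ≥0) (w : EuclideanSpace ℝ (Fin k)) (b : ℝ)
    (D : Kernel (HalfBall k) (HalfBall k)) (n : ℕ) :
    Measure (HalfBall k × History (HalfBall k) n) :=
  run (P.learner k f) (halfSpace w b) D n

lemma lintegral_law_succ_le [IsMarkovKernel D] {n : ℕ} {c : ℝ≥0∞} (hc : c ≠ ∞)
    {Φ : HalfBall k × History (HalfBall k) n → ℝ≥0∞}
    {Φ' : HalfBall k × History (HalfBall k) (n + 1) → ℝ≥0∞} (hΦ' : Measurable Φ')
    (h : ∀ ξ h, ∫⁻ x', Φ' (ξ, extend (halfSpace w b) h (P.nextQuery n ξ (P.state n (ξ, h))) x')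
      ∂(D (P.nextQuery n ξ (P.state n (ξ, h)))) ≤ c * Φ (ξ, h)) :
    ∫⁻ p, Φ' p ∂(P.law f w b D (n + 1)) ≤ c * ∫⁻ p, Φ p ∂(P.law f w b D n) :=
  lintegral_run_succ_le (P.learner k f) D (measurableSet_halfSpace w b) hc hΦ'
    fun p => h p.1 p.2

lemma lintegral_law_succ_le_self [IsMarkovKernel D] {n : ℕ}
    {Φ : HalfBall k × History (HalfBall k) n → ℝ≥0∞}
    {Φ' : HalfBall k × History (HalfBall k) (n + 1) → ℝ≥0∞} (hΦ' : Measurable Φ')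
    (h : ∀ ξ h, ∫⁻ x', Φ' (ξ, extend (halfSpace w b) h (P.nextQuery n ξ (P.state n (ξ, h))) x')
      ∂(D (P.nextQuery n ξ (P.state n (ξ, h)))) ≤ Φ (ξ, h)) :
    ∫⁻ p, Φ' p ∂(P.law f w b D (n + 1)) ≤ ∫⁻ p, Φ p ∂(P.law f w b D n) := by
  have := P.lintegral_law_succ_le (f := f) ENNReal.one_ne_top hΦ' (fun ξ h' => by
    rw [one_mul]
    exact h ξ h')
  rwa [one_mul] at this

lemma measurable_searchPotential_state (f : ℝ≥0 → ℝ≥0) (w : EuclideanSpace ℝ (Fin k)) (b : ℝ)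
    (n : ℕ) : Measurable fun p : HalfBall k × History (HalfBall k) n =>
      P.searchPotential f w b n p.1 (P.state n p) :=
  (P.measurable_searchPotential f w b n).comp (measurable_fst.prodMk (P.measurable_state n))

lemma lintegral_searchPotential_succ_le (hP : P.IsAdapted f) (hw : ‖w‖ = 1)
    (hD : IsBoundaryOracle f w b D) {n : ℕ} (hn : n < 2 * P.trials) :
    ∫⁻ p, P.searchPotential f w b (n + 1) p.1 (P.state (n + 1) p) ∂(P.law f w b D (n + 1)) ≤
      (if Even n then 13 / 16 else 1) *
        ∫⁻ p, P.searchPotential f w b n p.1 (P.state n p) ∂(P.law f w b D n) := by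
  have := hD.markov
  refine P.lintegral_law_succ_le (by split_ifs <;> finiteness)
    (P.measurable_searchPotential_state f w b (n + 1)) fun ξ h => ?_
  simp only [state_extend, update, nextQuery, if_pos hn]
  split_ifs with he
  · exact P.lintegral_searchPotential_recordCandidate hP hD he ξ _
  · rw [one_mul]
    exact P.lintegral_searchPotential_certify hP hw hD he ξ _

lemma gap_center_le (hne : (boundary w b).Nonempty) : gap w b (Contrastive.center k) ≤ 1 / 2 := by
  obtain ⟨z, hz⟩ := hne
  refine (gap_le_dist hz).trans ?_
  rw [Subtype.dist_eq, dist_eq_norm]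
  simpa [Contrastive.center] using z.norm_le

end SearchParams

namespace SearchParams

variable {m : ℕ} (P : SearchParams) {f : ℝ≥0 → ℝ≥0} {w : EuclideanSpace ℝ (Fin (m + 1))} {b : ℝ}
  {D : Kernel (HalfBall (m + 1)) (HalfBall (m + 1))}

lemma lintegral_searchPotential_zero_le (hP : P.IsAdapted f) (hw : ‖w‖ = 1)
    (hD : IsBoundaryOracle f w b D) :
    ∫⁻ p, P.searchPotential f w b 0 p.1 (P.state 0 p) ∂(P.law f w b D 0) ≤ 8 * 4 ^ P.target := by
  have h0 : ∫⁻ p, P.searchPotential f w b 0 p.1 (P.state 0 p) ∂(P.law f w b D 0) =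
      ∫⁻ ξ, P.searchPotential f w b 0 ξ (P.state 0 (ξ, Fin.elim0)) ∂(uniform (m + 1)) :=
    lintegral_run_zero (P.learner (m + 1) f) D (P.measurable_searchPotential_state f w b 0)
  rw [h0]
  have hae : ∀ᵐ ξ ∂(uniform (m + 1)), inner ℝ w ξ.1 ≠ 0 := by
    rw [ae_iff]
    simpa using uniform_hyperplane w hw
  have hle : ∀ᵐ ξ ∂(uniform (m + 1)),
      P.searchPotential f w b 0 ξ (P.state 0 (ξ, Fin.elim0)) ≤ 8 * 4 ^ P.target := by
    filter_upwards [hae] with ξ hξ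
    refine P.searchPotential_le ⟨fun _ => hξ, Nat.zero_le _, ?_, fun h => absurd h (lt_irrefl 0),
      fun _ => rfl, fun h => absurd h (lt_irrefl 0)⟩
    change gap w b (Contrastive.center _) ≤ P.radius 0
    rw [hP.radius_zero]
    simpa using gap_center_le hD.nonempty
  refine (lintegral_mono_ae hle).trans ?_
  rw [lintegral_const, measure_univ, mul_one]

lemma lintegral_searchPotential_le (hP : P.IsAdapted f) (hw : ‖w‖ = 1)
    (hD : IsBoundaryOracle f w b D) {j : ℕ} (hj : j ≤ P.trials) :
    ∫⁻ p, P.searchPotential f w b (2 * j) p.1 (P.state (2 * j) p) ∂(P.law f w b D (2 * j)) ≤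
      (13 / 16) ^ j * (8 * 4 ^ P.target) := by
  induction j with
  | zero =>
    rw [pow_zero, one_mul]
    exact P.lintegral_searchPotential_zero_le hP hw hD
  | succ j ih =>
    have h1 := P.lintegral_searchPotential_succ_le hP hw hD (n := 2 * j) (by omega)
    have h2 := P.lintegral_searchPotential_succ_le hP hw hD (n := 2 * j + 1) (by omega)
    rw [if_pos (even_two_mul j)] at h1
    rw [if_neg (by simp), one_mul] at h2
    refine (h2.trans h1).trans ?_
    rw [pow_succ', mul_assoc]
    gcongr
    exact ih (by omega)

open Classical in
/-- A penalty for an unsuitable final point. -/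
noncomputable def missPotential (w : EuclideanSpace ℝ (Fin (m + 1))) (b : ℝ)
    (s : SearchState (m + 1)) : ℝ≥0∞ :=
  if P.IsNice w b s.final then 0 else 32

lemma measurable_missPotential (w : EuclideanSpace ℝ (Fin (m + 1))) (b : ℝ) (n : ℕ) :
    Measurable fun p : HalfBall (m + 1) × History (HalfBall (m + 1)) n =>
      P.missPotential w b (P.state n p) := by
  unfold missPotential
  refine Measurable.ite ?_ measurable_const measurable_const
  exact (P.measurableSet_isNice w b).preimage
    (SearchState.measurable_final.comp (P.measurable_state n))

/-- The penalty `32 = 8 * 4` is the least value of the search potential at a sound state with a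
level missing. At complete sound states the settled point is almost surely nice. -/
lemma lintegral_missPotential_settle_le (hP : P.IsAdapted f) (hw : ‖w‖ = 1)
    (hD : IsBoundaryOracle f w b D) :
    ∫⁻ p, P.missPotential w b (P.state (2 * P.trials + 1) p)
      ∂(P.law f w b D (2 * P.trials + 1)) ≤
    ∫⁻ p, P.searchPotential f w b (2 * P.trials) p.1 (P.state (2 * P.trials) p)
      ∂(P.law f w b D (2 * P.trials)) := by
  have := hD.markov
  refine P.lintegral_law_succ_le_self (P.measurable_missPotential w b _) fun ξ h => ?_
  simp only [state_extend, update, nextQuery, lt_irrefl, if_false, if_true]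
  set s := P.state (2 * P.trials) (ξ, h)
  by_cases hs : P.IsSound w b (2 * P.trials) ξ s
  swap
  · rw [P.searchPotential_of_not_isSound hs]
    exact le_top
  by_cases ht : P.target ≤ s.level
  · refine le_trans (le_of_eq ?_) zero_le
    rw [← lintegral_zero (μ := D (P.firstProbe ξ s))]
    refine lintegral_congr_ae ?_
    filter_upwards [P.isNice_settle hP hw hD hs ht] with x' hx'
    exact if_pos hx'
  · have h1 : P.searchPotential f w b (2 * P.trials) ξ s = 8 * 4 ^ (P.target - s.level) := by
      rw [searchPotential, if_pos hs, if_neg ht, if_neg (fun h => h.1 (even_two_mul _))]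
    rw [h1]
    have h2 : (32 : ℝ≥0∞) ≤ 8 * 4 ^ (P.target - s.level) := by
      calc (32 : ℝ≥0∞) = 8 * 4 ^ 1 := by norm_num
        _ ≤ _ := by
          gcongr
          · norm_num
          · omega
    refine le_trans (lintegral_mono (g := fun _ => 32) fun x' => ?_) ?_
    · unfold missPotential
      split_ifs
      · exact zero_le
      · exact le_rfl
    · rw [lintegral_const, measure_univ, mul_one]
      exact h2
lemma lintegral_missPotential_succ_le [IsMarkovKernel D] {n : ℕ} (hn : 2 * P.trials < n) :
    ∫⁻ p, P.missPotential w b (P.state (n + 1) p) ∂(P.law f w b D (n + 1)) ≤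
      ∫⁻ p, P.missPotential w b (P.state n p) ∂(P.law f w b D n) := by
  refine P.lintegral_law_succ_le_self (P.measurable_missPotential w b _) fun ξ h => ?_
  simp only [state_extend, update, if_neg (show ¬ n < 2 * P.trials by omega),
    if_neg (show ¬ n = 2 * P.trials by omega)]
  rw [lintegral_const, measure_univ, mul_one]

lemma lintegral_missPotential_le (hP : P.IsAdapted f) (hw : ‖w‖ = 1)
    (hD : IsBoundaryOracle f w b D) {n : ℕ} (hn : 2 * P.trials + 1 ≤ n) :
    ∫⁻ p, P.missPotential w b (P.state n p) ∂(P.law f w b D n) ≤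
      (13 / 16) ^ P.trials * (8 * 4 ^ P.target) := by
  have := hD.markov
  induction n, hn using Nat.le_induction with
  | base =>
    exact (P.lintegral_missPotential_settle_le hP hw hD).trans
      (P.lintegral_searchPotential_le hP hw hD le_rfl)
  | succ n hn ih => exact (P.lintegral_missPotential_succ_le hn).trans ih

open Classical in
/-- The examples for the final point favour the target: examples that disagree with it increase the
potential, and examples that agree with it decrease the potential. -/
noncomputable def votePotential (f : ℝ≥0 → ℝ≥0) (w : EuclideanSpace ℝ (Fin (m + 1))) (b : ℝ)
    (n : ℕ) (p : HalfBall (m + 1) × History (HalfBall (m + 1)) n) : ℝ≥0∞ :=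
  if P.IsNice w b (P.state n p).final then
    ∏ j : Fin n, if 2 * P.trials < j then
      if Agrees f w b (P.state n p).final (p.2 j) then 5 / 6 else 6 / 5
    else 1
  else 0

lemma measurable_votePotential (hf : Measurable f) (w : EuclideanSpace ℝ (Fin (m + 1))) (b : ℝ)
    (n : ℕ) : Measurable (P.votePotential f w b n) := by
  have hs := SearchState.measurable_final.comp (P.measurable_state (k := m + 1) n)
  unfold votePotential
  refine Measurable.ite ((P.measurableSet_isNice w b).preimage hs) ?_ measurable_const
  refine Finset.measurable_prod _ fun j _ => ?_
  refine Measurable.ite (MeasurableSet.const _) ?_ measurable_const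
  refine Measurable.ite ?_ measurable_const measurable_const
  exact (measurableSet_agrees hf w b).preimage
    (hs.prodMk ((measurable_pi_apply j).comp measurable_snd))

lemma votePotential_extend {n : ℕ} (hn : 2 * P.trials < n) {ξ : HalfBall (m + 1)}
    {h : History (HalfBall (m + 1)) n} (x' : HalfBall (m + 1)) :
    open Classical in
    P.votePotential f w b (n + 1) (ξ, extend (halfSpace w b) h (P.state n (ξ, h)).final x') =
      P.votePotential f w b n (ξ, h) *
        if Agrees f w b (P.state n (ξ, h)).final
          (exampleOf w b (P.state n (ξ, h)).final x') then 5 / 6 else 6 / 5 := by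
  have hst : P.state (n + 1) (ξ, extend (halfSpace w b) h (P.state n (ξ, h)).final x') =
      P.state n (ξ, h) := by
    rw [state_extend, update, if_neg (by omega), if_neg (by omega)]
  have hlast : (ξ, extend (halfSpace w b) h (P.state n (ξ, h)).final x').2 (Fin.last n) =
      exampleOf w b (P.state n (ξ, h)).final x' := by
    simp only [extend, Fin.snoc_last]
    rfl
  have hcast : ∀ j : Fin n,
      (ξ, extend (halfSpace w b) h (P.state n (ξ, h)).final x').2 j.castSucc = h j :=
    fun j => by simp only [extend, Fin.snoc_castSucc]
  unfold votePotential
  rw [hst]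
  by_cases hy : P.IsNice w b (P.state n (ξ, h)).final
  · rw [if_pos hy, if_pos hy, Fin.prod_univ_castSucc]
    congr 1
    · refine Finset.prod_congr rfl fun j _ => ?_
      rw [hcast]
      rfl
    · rw [hlast]
      exact if_pos hn
  · rw [if_neg hy, if_neg hy, zero_mul]

/-- Markov's inequality with constant 12/5 bounds the probability of disagreement by 5/12, and `5 /
6 * (7 / 12) + 6 / 5 * (5 / 12) = 71 / 72`. -/
lemma lintegral_votePotential_succ_le (hP : P.IsAdapted f) (hw : ‖w‖ = 1)
    (hD : IsBoundaryOracle f w b D) {n : ℕ} (hn : 2 * P.trials < n) :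
    ∫⁻ p, P.votePotential f w b (n + 1) p ∂(P.law f w b D (n + 1)) ≤
      71 / 72 * ∫⁻ p, P.votePotential f w b n p ∂(P.law f w b D n) := by
  classical
  have := hD.markov
  refine P.lintegral_law_succ_le (by finiteness)
    (P.measurable_votePotential hP.mono.measurable w b _) fun ξ h => ?_
  have hq : P.nextQuery n ξ (P.state n (ξ, h)) = (P.state n (ξ, h)).final := by
    rw [nextQuery, if_neg (by omega), if_neg (by omega)]
  rw [hq]
  simp only [P.votePotential_extend hn]
  by_cases hy : P.IsNice w b (P.state n (ξ, h)).final
  swap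
  · have : P.votePotential f w b n (ξ, h) = 0 := if_neg hy
    simp [this]
  set y := (P.state n (ξ, h)).final
  have hfin : P.votePotential f w b n (ξ, h) ≠ ∞ := by
    unfold votePotential
    rw [if_pos hy]
    refine ENNReal.prod_ne_top fun j _ => ?_
    split_ifs <;> finiteness
  rw [lintegral_const_mul' _ _ hfin, mul_comm]
  gcongr
  have hbad : D y {x' | ¬ Agrees f w b y (exampleOf w b y x')} ≤ ENNReal.ofReal (12 / 5)⁻¹ := by
    refine (measure_mono ?_).trans (hD.dist_foot hw hy.norm_foot (by norm_num))
    exact fun x' hx' hd => hx' ⟨Iff.rfl, hd⟩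
  refine (lintegral_le_of_ae_le_of_measure_le (a := 5 / 6) (c := 11 / 30) hbad
    (Filter.Eventually.of_forall fun x' hx' => (if_pos hx').le)
    (Filter.Eventually.of_forall fun x' => ?_)).trans (le_of_eq ?_)
  · have h1 : (5 / 6 + 11 / 30 : ℝ≥0∞) = 6 / 5 := by
      rw [← ENNReal.toReal_eq_toReal_iff' (by finiteness) (by finiteness),
        ENNReal.toReal_add (by finiteness) (by finiteness)]
      simp
      norm_num
    rw [h1]
    split_ifs
    · rw [← h1]
      exact le_self_add
    · exact le_rfl
  · rw [← ENNReal.toReal_eq_toReal_iff' (by finiteness) (by finiteness),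
      ENNReal.toReal_add (by finiteness) (by finiteness), ENNReal.toReal_mul,
      ENNReal.toReal_ofReal (by norm_num)]
    simp
    norm_num

lemma lintegral_votePotential_le (hP : P.IsAdapted f) (hw : ‖w‖ = 1)
    (hD : IsBoundaryOracle f w b D) (i : ℕ) :
    ∫⁻ p, P.votePotential f w b (2 * P.trials + 1 + i) p
      ∂(P.law f w b D (2 * P.trials + 1 + i)) ≤ (71 / 72) ^ i := by
  have := hD.markov
  have hprob : IsProbabilityMeasure (P.law f w b D (2 * P.trials + 1)) :=
    isProbabilityMeasure_run (P.learner (m + 1) f) D (measurableSet_halfSpace w b) _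
  induction i with
  | zero =>
    rw [pow_zero, ← measure_univ (μ := P.law f w b D (2 * P.trials + 1)), ← lintegral_one]
    refine lintegral_mono fun p => ?_
    unfold votePotential
    split_ifs
    · refine Finset.prod_le_one' fun j _ => ?_
      -- No index exceeds `2 * P.trials` yet, so no vote has been cast and every factor is 1.
      rw [if_neg (by have := j.2; omega)]
    · exact zero_le
  | succ i ih =>
    rw [pow_succ']
    refine (P.lintegral_votePotential_succ_le (n := 2 * P.trials + 1 + i) hP hw hD
      (by omega)).trans ?_
    gcongr

/-- The factors 5/6 and 6/5 are inverse to each other, so the product is at least 1 unless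
agreements outnumber disagreements. -/
lemma one_le_votePotential {n : ℕ} (hw : ‖w‖ = 1)
    {p : HalfBall (m + 1) × History (HalfBall (m + 1)) n}
    (hy : P.IsNice w b (P.state n p).final)
    (hex : ¬ P.Explains f p.2 (P.state n p).final w b) :
    1 ≤ P.votePotential f w b n p := by
  classical
  have hmaj := not_lt.1 fun h => hex ⟨hw, hy, h⟩
  rw [votePotential, if_pos hy]
  rw [Finset.prod_ite, Finset.prod_const_one, mul_one, Finset.prod_ite, Finset.prod_const,
    Finset.prod_const, Finset.filter_filter, Finset.filter_filter]
  refine le_trans ?_ (mul_le_mul_right (pow_le_pow_right₀ ?_ hmaj) _)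
  · rw [← mul_pow]
    have : (5 / 6 * (6 / 5) : ℝ≥0∞) = 1 := by
      rw [← ENNReal.toReal_eq_toReal_iff' (by finiteness) (by finiteness)]
      simp
    rw [this, one_pow]
  · rw [ENNReal.le_div_iff_mul_le (by simp) (by simp)]
    norm_num

end SearchParams

/-! ### Failure probability and the choice of constants -/

namespace SearchParams

variable {m : ℕ} (P : SearchParams) {f : ℝ≥0 → ℝ≥0} {w : EuclideanSpace ℝ (Fin (m + 1))} {b : ℝ}
  {D : Kernel (HalfBall (m + 1)) (HalfBall (m + 1))}

/-- An error above `ε` means that the final point is unsuitable or that the target lost the vote;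
Markov's inequality for the two potentials bounds both events. -/
lemma measure_error_le (hP : P.IsAdapted f) (hw : ‖w‖ = 1) (hD : IsBoundaryOracle f w b D)
    {c ε : ℝ} (hc : 0 < c) (hfc : ∀ x, f x ≤ x ^ (1 + c) / 4) (hε : 0 < ε) (hε1 : ε ≤ 1)
    (htol : P.tol ≤ 27 / 128) (htolc : P.tol ^ c ≤ ε / 2 ^ m) (i : ℕ) :
    P.law f w b D (2 * P.trials + 1 + i)
        {p | ε < err (uniform (m + 1)) (P.guess f _ p) (halfSpace w b)} ≤
      (13 / 16) ^ P.trials * 4 ^ P.target + (71 / 72) ^ i := by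
  set n := 2 * P.trials + 1 + i
  set ν := P.law f w b D n
  have hsub : {p | ε < err (uniform (m + 1)) (P.guess f n p) (halfSpace w b)} ⊆
      {p | 32 ≤ P.missPotential w b (P.state n p)} ∪ {p | 1 ≤ P.votePotential f w b n p} := by
    intro p hp
    by_cases hy : P.IsNice w b (P.state n p).final
    · right
      refine P.one_le_votePotential hw hy fun hex => ?_
      exact absurd hp (not_lt.2 (P.err_guess_le hc hfc hε hε1 htol htolc hex))
    · left
      rw [mem_ofPred_eq, missPotential, if_neg hy]
  refine (measure_mono hsub).trans ((measure_union_le _ _).trans (add_le_add ?_ ?_))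
  · have h1 := (mul_meas_ge_le_lintegral (μ := ν) (P.measurable_missPotential w b n) 32).trans
      (P.lintegral_missPotential_le hP hw hD (Nat.le_add_right _ _))
    -- The penalty 32 is weakened to 8, to cancel against the initial potential `8 * 4 ^ P.target`.
    have h2 : 8 * ν {p | 32 ≤ P.missPotential w b (P.state n p)} ≤
        8 * ((13 / 16) ^ P.trials * 4 ^ P.target) := by
      refine le_trans (mul_le_mul_left (by norm_num) _) (h1.trans (le_of_eq (by ring)))
    exact (ENNReal.mul_le_mul_iff_right (by norm_num) (by norm_num)).1 h2
  · have h1 := (mul_meas_ge_le_lintegral (μ := ν)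
      (P.measurable_votePotential hP.mono.measurable w b n) 1).trans
      (P.lintegral_votePotential_le hP hw hD i)
    rwa [one_mul] at h1

end SearchParams

/-- A target with an admissible oracle is bounded by a proper hyperplane. -/
lemma exists_unit_normal {k : ℕ} {f : ℝ≥0 → ℝ≥0} {ℓ : Set (HalfBall k)} (hℓ : ℓ ∈ halfSpaces k)
    {D : Kernel (HalfBall k) (HalfBall k)} (hD : D ∈ probAMDM f ℓ) :
    ∃ (w : EuclideanSpace ℝ (Fin k)) (b : ℝ), ‖w‖ = 1 ∧ ℓ = halfSpace w b := by
  obtain ⟨w, b, rfl⟩ := hℓ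
  have hw : w ≠ 0 := by
    rintro rfl
    obtain ⟨-, h⟩ := hD
    obtain ⟨-, xm, hxm, -⟩ := h (center k)
    obtain ⟨y, hy⟩ := closure_nonempty_iff.1 ⟨xm, hxm.1⟩
    simp [oppositeLabel] at hy
  have hpos : 0 < ‖w‖ := norm_pos_iff.2 hw
  refine ⟨‖w‖⁻¹ • w, ‖w‖⁻¹ * b, ?_, ?_⟩
  · rw [norm_smul, norm_inv, norm_norm, inv_mul_cancel₀ hpos.ne']
  · ext x
    simp only [halfSpace, mem_ofPred_eq, real_inner_smul_left]
    exact (mul_le_mul_iff_right₀ (inv_pos.2 hpos)).symm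

/-- Sixteen attempts pay for the factor 4 of one level. The three additional levels cost 64,
absorbed by the first two blocks of 14 attempts; this is why `2 ≤ j`. -/
lemma chain_failure_le (S : ℕ) {j : ℕ} (hj : 2 ≤ j) :
    ((13 / 16 : ℝ) ^ (16 * S + 14 * j)) * 4 ^ (S + 3) ≤ (1 / 2) ^ j := by
  obtain ⟨i, rfl⟩ := Nat.exists_eq_add_of_le hj
  have h1 : ((13 / 16 : ℝ) ^ 16 * 4) ^ S ≤ 1 := pow_le_one₀ (by positivity) (by norm_num)
  have h2 : ((13 / 16 : ℝ) ^ 14) ^ i ≤ (1 / 2) ^ i := pow_le_pow_left₀ (by positivity)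
    (by norm_num) i
  calc _ = ((13 / 16 : ℝ) ^ 16 * 4) ^ S * (((13 / 16 : ℝ) ^ 14) ^ i *
        (((13 / 16 : ℝ) ^ 14) ^ 2 * 64)) := by
        rw [pow_add, pow_mul, pow_mul, pow_add _ 2 i, pow_add (4 : ℝ), mul_pow]
        norm_num
        ring
    _ ≤ 1 * ((1 / 2) ^ i * (1 / 2) ^ 2) := by
        gcongr
        norm_num
    _ = _ := by ring

lemma vote_failure_le (j : ℕ) : (71 / 72 : ℝ) ^ (50 * j) ≤ (1 / 2) ^ j := by
  rw [pow_mul]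
  exact pow_le_pow_left₀ (by positivity) (by norm_num) j

/-- With `16 * S + 14 * j` attempts, one probe and `50 * j` votes, the number of queries is `32 * S
+ 78 * j + 1`. For `j = ⌈L⌉₊` the part with `j` is below `78 * L + 79`, which is at most `136 * L`
since `L ≥ 3 / 2`. -/
lemma exists_confidence_exponent {δ : ℝ} (hδ : 0 < δ) (hδ1 : δ ≤ 1) :
    ∃ j : ℕ, 2 ≤ j ∧ (1 / 2 : ℝ) ^ j ≤ δ / 3 ∧ (78 * j + 1 : ℝ) ≤ 136 * Real.logb 2 (3 / δ) := by
  have h3 : 3 ≤ 3 / δ := by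
    rw [le_div_iff₀ hδ]
    linarith
  set L := Real.logb 2 (3 / δ) with hL
  have hL1 : 3 / 2 ≤ L := by
    rw [hL, Real.le_logb_iff_rpow_le one_lt_two (by linarith)]
    refine le_trans ?_ h3
    -- Squaring reduces `2 ^ (3 / 2) ≤ 3` to `8 ≤ 9`.
    refine le_of_sq_le_sq ?_ (by norm_num)
    rw [← Real.rpow_natCast, ← Real.rpow_mul (by norm_num)]
    norm_num
  refine ⟨⌈L⌉₊, ?_, ?_, ?_⟩
  · exact Nat.lt_ceil.2 (by push_cast; linarith)
  · have h4 : 3 / δ ≤ 2 ^ ⌈L⌉₊ := by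
      rw [← Real.rpow_natCast, ← Real.logb_le_iff_le_rpow one_lt_two (by positivity)]
      exact Nat.le_ceil L
    rw [one_div, inv_pow, inv_le_comm₀ (by positivity) (by positivity), inv_div]
    exact h4
  · have := Nat.ceil_lt_add_one (show 0 ≤ L by linarith)
    linarith

/-- The radii of the search are dominated by the iterates in the bound. -/
lemma iterate_noise_le {f : ℝ≥0 → ℝ≥0} (hf : Monotone f) (n : ℕ) (u : ℝ≥0) :
    (fun x => 3 * f x)^[n] u ≤ (fun x => 3 * f (2 * x))^[n] u := by
  refine Monotone.iterate_le_of_le (f := fun x => 3 * f x) (fun x y h => ?_) (fun x => ?_) n u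
  · exact mul_le_mul_right (hf h) 3
  · refine mul_le_mul_right (hf ?_) 3
    exact le_mul_of_one_le_left zero_le one_le_two

lemma iterate_noise_succ_le {f : ℝ≥0 → ℝ≥0} (hf4 : ∀ x ≤ 1, f x ≤ x / 4) (n : ℕ) :
    (fun x => 3 * f x)^[n] (1 / 2) ≤ 1 / 2 ∧
      (fun x => 3 * f x)^[n + 1] (1 / 2) ≤ 3 / 4 * (fun x => 3 * f x)^[n] (1 / 2) := by
  have key : ∀ x : ℝ≥0, x ≤ 1 / 2 → 3 * f x ≤ 3 / 4 * x := fun x hx => by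
    have h1 : x ≤ 1 := hx.trans (by
      rw [← NNReal.coe_le_coe]
      norm_num)
    calc 3 * f x ≤ 3 * (x / 4) := mul_le_mul_right (hf4 x h1) 3
      _ = 3 / 4 * x := by ring
  induction n with
  | zero => exact ⟨le_rfl, key _ le_rfl⟩
  | succ n ih =>
    have h : (fun x => 3 * f x)^[n + 1] (1 / 2) ≤ 1 / 2 := by
      refine ih.2.trans ((mul_le_mul_right ih.1 _).trans ?_)
      rw [← NNReal.coe_le_coe]
      norm_num
    refine ⟨h, ?_⟩
    rw [Function.iterate_succ_apply' _ (n + 1)]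
    exact key _ h

lemma exists_iterate_le_of_iterationCount {f : ℝ≥0 → ℝ≥0} {u : ℝ≥0} {b : ℝ}
    (h : iterationCount f u b ≠ ⊤) :
    ∃ n : ℕ, ((f^[n] u : ℝ≥0) : ℝ) ≤ b ∧ (n : ℕ∞) ≤ iterationCount f u b := by
  classical
  have hex : ∃ n : ℕ, ((f^[n] u : ℝ≥0) : ℝ) ≤ b := by
    by_contra! hcon
    refine h (top_le_iff.1 (le_iInf₂ fun n hn => ?_))
    exact absurd hn (not_le.2 (hcon n))
  refine ⟨Nat.find hex, Nat.find_spec hex, le_iInf₂ fun n hn => ?_⟩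
  exact_mod_cast Nat.find_min' hex hn

/-- The search learner with `S + 3` levels. -/
lemma exists_adapted_params {f : ℝ≥0 → ℝ≥0} (hf : Monotone f) (hf4 : ∀ x ≤ 1, f x ≤ x / 4)
    {S T : ℕ} (hT : 0 < T) {η : ℝ} (hη : 0 < η)
    (hS : (((fun x => 3 * f (2 * x))^[S] (1 / 2) : ℝ≥0) : ℝ) ≤ η) :
    ∃ P : SearchParams, P.IsAdapted f ∧ P.target = S + 3 ∧ P.trials = T ∧ P.tol ≤ 27 / 128 ∧
      P.tol ≤ η := by
  set r : ℕ → ℝ≥0 := fun i => (fun x => 3 * f x)^[i] (1 / 2) with hr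
  have hrS : (r S : ℝ) ≤ min (1 / 2) η := by
    refine le_min ?_ (le_trans ?_ hS)
    · simpa using NNReal.coe_le_coe.2 (show r S ≤ 1 / 2 from (iterate_noise_succ_le hf4 S).1)
    · exact_mod_cast iterate_noise_le hf S (1 / 2)
  have hstep : ∀ i, (r (i + 1) : ℝ) ≤ 3 / 4 * r i := fun i => by
    simpa using NNReal.coe_le_coe.2
      (show r (i + 1) ≤ 3 / 4 * r i from (iterate_noise_succ_le hf4 i).2)
  have hm0 : 0 < min (1 / 2) η := lt_min (by norm_num) hη
  have hm1 : min (1 / 2) η ≤ 1 / 2 := min_le_left _ _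
  -- Each level shrinks the radius by at least 3/4, so three levels beyond `S` gain `(3 / 4) ^ 3 =
  -- 27 / 64`. Together with the starting radius 1/2 this gives the bound 27/128 on the margin.
  refine ⟨⟨S + 3, T, r, 27 / 64 * min (1 / 2) η⟩, ⟨hf, hf4, rfl, fun i => ?_, Nat.succ_pos _, ?_,
    by positivity, ?_, hT⟩, rfl, rfl, ?_, ?_⟩
  · exact Function.iterate_succ_apply' _ _ _
  · change (r (S + 3) : ℝ) ≤ 27 / 64 * min (1 / 2) η
    linarith [hstep S, hstep (S + 1), hstep (S + 2)]
  · change 2 * (27 / 64 * min (1 / 2) η) ≤ 1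
    linarith
  · change 27 / 64 * min (1 / 2) η ≤ 27 / 128
    linarith
  · change 27 / 64 * min (1 / 2) η ≤ η
    linarith [min_le_right (1 / 2) η]

end Contrastive

open Contrastive in
theorem corollary3 (k : ℕ) (hk : 1 ≤ k) (c : ℝ) (hc : 0 < c) (f : ℝ≥0 → ℝ≥0)
    (hf : Monotone f) (hfc : ∀ x, f x ≤ x ^ (1 + c) / 4) (ε δ : ℝ)
    (hε : 0 < ε) (hε1 : ε ≤ 1) (hδ : 0 < δ) (hδ1 : δ ≤ 1) :
    (Contrastive.activeSampleComplexity (Contrastive.uniform k) (Contrastive.halfSpaces k)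
        (Contrastive.probAMDM f) ε δ : ℝ≥0∞) ≤
      32 * (Contrastive.iterationCount (fun x => 3 * f (2 * x)) (1 / 2)
        ((ε / (2 : ℝ) ^ ((k : ℝ) - 1)) ^ (1 / c)) : ℝ≥0∞) +
      ENNReal.ofReal (136 * Real.logb 2 (3 / δ)) := by
  obtain ⟨m, rfl⟩ := Nat.exists_eq_add_of_le' hk
  have hpow : (2 : ℝ) ^ (((m + 1 : ℕ) : ℝ) - 1) = 2 ^ m := by
    rw [← Real.rpow_natCast]
    congr 1
    push_cast
    ring
  rw [hpow]
  set η := (ε / 2 ^ m) ^ (1 / c) with hη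
  have hη0 : 0 < η := by positivity
  by_cases htop : iterationCount (fun x => 3 * f (2 * x)) (1 / 2) η = ⊤
  · rw [htop]
    simp
  obtain ⟨S, hS, hSle⟩ := exists_iterate_le_of_iterationCount htop
  obtain ⟨j, hj2, hjδ, hjL⟩ := exists_confidence_exponent hδ hδ1
  have hf4 : ∀ x ≤ 1, f x ≤ x / 4 := fun x hx => (hfc x).trans (by
    gcongr
    rcases eq_or_ne x 0 with rfl | h0
    · rw [NNReal.zero_rpow (by linarith)]
    · calc x ^ (1 + c) ≤ x ^ (1 : ℝ) :=
            NNReal.rpow_le_rpow_of_exponent_ge (pos_iff_ne_zero.2 h0) hx (by linarith)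
        _ = x := NNReal.rpow_one x)
  obtain ⟨P, hP, hPN, hPT, htol, htolη⟩ :=
    exists_adapted_params hf hf4 (T := 16 * S + 14 * j) (by omega) hη0 hS
  have htolc : P.tol ^ c ≤ ε / 2 ^ m := by
    calc P.tol ^ c ≤ η ^ c := Real.rpow_le_rpow hP.tol_pos.le htolη hc.le
      _ = ε / 2 ^ m := by
        rw [hη, ← Real.rpow_mul (by positivity), one_div_mul_cancel hc.ne', Real.rpow_one]
  have hmain : activeSampleComplexity (uniform (m + 1)) (halfSpaces (m + 1)) (probAMDM f) ε δ ≤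
      ((32 * S + (78 * j + 1) : ℕ) : ℕ∞) := by
    refine (iInf_le _ (P.learner (m + 1) f)).trans (iInf₂_le _ fun ℓ hℓ D hD n hn => ?_)
    obtain ⟨w, b, hw, rfl⟩ := exists_unit_normal hℓ hD
    obtain ⟨i, rfl⟩ := Nat.exists_eq_add_of_le (show 2 * P.trials + 1 ≤ n by omega)
    refine lt_of_le_of_lt (P.measure_error_le hP hw (isBoundaryOracle_of_mem hD) hc hfc hε hε1
      htol htolc i) ?_
    have h1 : (13 / 16 : ℝ≥0∞) ^ P.trials * 4 ^ P.target ≤ ENNReal.ofReal (δ / 3) := by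
      rw [hPT, hPN]
      have := ENNReal.ofReal_le_ofReal ((chain_failure_le S hj2).trans hjδ)
      rwa [ENNReal.ofReal_mul (by positivity), ENNReal.ofReal_pow (by norm_num),
        ENNReal.ofReal_pow (by norm_num), ENNReal.ofReal_div_of_pos (by norm_num),
        ENNReal.ofReal_ofNat, ENNReal.ofReal_ofNat, ENNReal.ofReal_ofNat] at this
    have h2 : (71 / 72 : ℝ≥0∞) ^ i ≤ ENNReal.ofReal (δ / 3) := by
      have hi : (71 / 72 : ℝ) ^ i ≤ δ / 3 := by
        refine le_trans ?_ ((vote_failure_le j).trans hjδ)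
        exact pow_le_pow_of_le_one (by norm_num) (by norm_num) (by omega)
      have := ENNReal.ofReal_le_ofReal hi
      rwa [ENNReal.ofReal_pow (by norm_num), ENNReal.ofReal_div_of_pos (by norm_num),
        ENNReal.ofReal_ofNat, ENNReal.ofReal_ofNat] at this
    refine lt_of_le_of_lt (add_le_add h1 h2) ?_
    rw [← ENNReal.ofReal_add (by positivity) (by positivity)]
    -- Two failures of probability at most `δ / 3` each keep the total strictly below `δ`.
    exact (ENNReal.ofReal_lt_ofReal_iff hδ).2 (by linarith)
  calc (activeSampleComplexity (uniform (m + 1)) (halfSpaces (m + 1)) (probAMDM f) ε δ : ℝ≥0∞)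
      ≤ (((32 * S + (78 * j + 1) : ℕ) : ℕ∞) : ℝ≥0∞) := by exact_mod_cast hmain
    _ = 32 * ((S : ℕ∞) : ℝ≥0∞) + ENNReal.ofReal (78 * j + 1) := by
        rw [show (78 * j + 1 : ℝ) = ((78 * j + 1 : ℕ) : ℝ) by push_cast; ring,
          ENNReal.ofReal_natCast]
        simp
    _ ≤ _ := by
        gcongr
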